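/- **Theorem.** Let $n\ge 0$ be an integer and let $t\ge 0$ be real. *Plane forests.* A plane forest is a finite forest with unlabeled nodes in which each component (a plane tree) has a root, and in which the components, as well as the subtrees at each node, are linearly ordered from left to right. The degree of a node is its number of successors (children). The degree sequence of a plane tree lists the degrees of its nodes in depth-first traversal (root first, subtrees from left to right); its last entry is $0$. The reduced degree sequence of a plane forest is obtained by erasing the last entry from the degree sequence of each component and concatenating the results from left to right. For a forest on $n+1$ nodes with $m$ components it has the form $(d_1,\dots,d_{n+1-m})$. *Search.* For a graph $G$ on the nodes $1,\dots,n+1$, order the components by decreasing maximal label and perform the neighbors-first search (NFS) on each of them: start at the node of maximal label, which is the first active node; visit the unvisited neighbors of the active node in decreasing order of their labels, and make the one visited last the new active node; if the active node has no unvisited neighbor, the new active node is the last visited node that has not yet been active. Let $\Phi(G)$ be the resulting search forest, with each component rooted at its maximal label, and let $\Psi(G)$ be the plane forest obtained from $\Phi(G)$ by deleting the labels, where successors of a node are ordered from left to right by increasing labels and components by decreasing labels of their roots. *Polytopes.* Let $T$ be a plane tree on $a$ nodes. Visit its nodes as in the NFS: the root is the $0$-th visited node and the first active one; the successors of the active node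 are visited from right to left; the next active node is the last visited node that has not yet been active. Attach to the $i$-th visited node the coordinate $x_i/(1+t)^j$, where $j=0$ for the root, and where $j+r$ is the exponent of a node if $j$ is that of its parent and $r$ is the number of its siblings to its right. Let $D_T(t)\subset\mathbb R^{a-1}$ be the set of points $(x_1,\dots,x_{a-1})$ such that for each node with $k\ge1$ successors, which carry the coordinates $c_1,\dots,c_k$ from left to right, we have $1\le c_1\le\dots\le c_k\le 1+t$. For $P\subset\mathbb R^N$ let $$\operatorname{cone}(P)=\{(x_0,x_1,\dots,x_N): 0\le x_0\le 1,\ (x_1,\dots,x_N)\in x_0P\}\subset\mathbb R^{N+1}.$$ For a plane forest $F$ on $n+1$ nodes with components $T_1,\dots,T_m$ (from left to right) let $$D_F(t)=D_{T_1}(t)\times\operatorname{cone}\bigl(D_{T_2}(t)\times\operatorname{cone}(D_{T_3}(t)\times\cdots)\bigr)\subset\mathbb R^n,$$ where the innermost factor is $\operatorname{cone}(D_{T_m}(t))$ if $m\ge2$, and $D_F(t)=D_{T_1}(t)$ if $m=1$. Finally, with $x_0=1$, let $$G_n(t)=\{(x_1,\dots,x_n): 0\le x_i\le(1+t)x_{i-1}\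 \text{for } i=1,\dots,n\}.$$ Then the following hold, where $0^0=1$ and $|E(G)|$ is the number of edges of $G$. 1. For each plane forest $F$ on $n+1$ nodes, with $m$ components having $a_1,\dots,a_m$ nodes from left to right and with reduced degree sequence $(d_1,\dots,d_{n+1-m})$, the set $D_F(t)$ is a bounded polytope, and $$n!\,\operatorname{vol}D_F(t)=\sum_{G:\ \Psi(G)=F}t^{|E(G)|}=\frac{n!/(d_1!\,d_2!\cdots d_{n+1-m}!)}{\prod_{j=2}^m(a_j+\dots+a_m)}\;t^{\sum_i d_i}\,(1+t)^{\binom{n+2-m}2-\sum_i i\,d_i},$$ where the sum is over the graphs $G$ on the labeled nodes $1,\dots,n+1$ with $\Psi(G)=F$, and $i$ runs over $1,\dots,n+1-m$. 2. The polytopes $D_F(t)$, where $F$ runs over the plane forests on $n+1$ nodes, form a subdivision of $G_n(t)$: there are finitely many such $F$, the union of the $D_F(t)$ is $G_n(t)$, for $F\ne F'$ the interiors of $D_F(t)$ and $D_{F'}(t)$ are disjoint, and $D_F(t)\cap D_{F'}(t)$ is a (possibly empty) face of both. If $t>0$, each $D_F(t)$ has non-empty interior (for $t=0$ some of these polytopes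 may be lower-dimensional, and some may coincide). 3. In particular, $$n!\,\operatorname{vol}G_n(t)=\sum_{G}t^{|E(G)|}=(1+t)^{\binom{n+1}2},$$ where the sum is over all graphs $G$ on the labeled nodes $1,\dots,n+1$. -/

import Mathlib

open scoped Nat
open MeasureTheory

/-! ### Plane forests -/

/-- A plane forest: either empty, or a leftmost plane tree followed (to its right) by a plane
forest `rest`.  The leftmost tree is a root together with the plane forest `children` of the
subtrees at that root, listed from left to right.  So a plane tree is the same thing as the
plane forest of the subtrees at its root. -/
inductive PlaneForest : Type
  | nil : PlaneForest
  | cons (children rest : PlaneForest) : PlaneForest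

namespace PlaneForest

/-- Number of nodes. -/
def numNodes : PlaneForest → ℕ
  | nil => 0
  | cons C R => C.numNodes + 1 + R.numNodes

/-- Number of components (trees) of a plane forest. -/
def numTrees : PlaneForest → ℕ
  | nil => 0
  | cons _ R => R.numTrees + 1

/-- Numbers of nodes `a₁, a₂, …, aₘ` of the components, from left to right. -/
def treeSizes : PlaneForest → List ℕ
  | nil => []
  | cons C R => (C.numNodes + 1) :: R.treeSizes

/-- Degree sequence: numbers of successors of the nodes, in depth-first traversal. -/
def degSeq : PlaneForest → List ℕ
  | nil => []
  | cons C R => (C.numTrees :: C.degSeq) ++ R.degSeq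

/-- Reduced degree sequence: from the degree sequence of each component the last entry (a zero,
since the last node of a tree in depth-first traversal is a leaf) is erased. -/
def redDegSeq : PlaneForest → List ℕ
  | nil => []
  | cons C R => (C.numTrees :: C.degSeq).dropLast ++ R.redDegSeq

/-- Coordinates of `k` siblings, from left to right, when their parent carries the exponent `j`
and `p` non-root nodes have been visited before them.  The pair `(i, e)` stands for
`x_{i+1} / (1+t)^e` (points are indexed from `0`).  Siblings are visited from right to left, so
that the rightmost one gets `(p, j)`, and the leftmost one `(p + k - 1, j + k - 1)`. -/
def siblings (p j k : ℕ) : List (ℕ × ℕ) :=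
  (List.range k).reverse.map fun r => (p + r, j + r)

/-- Let `F` be the forest of the subtrees at a node that carries the exponent `j`, and let `p`
non-root nodes have been visited when the leftmost node of `F` becomes active (in particular all
roots of `F` have been visited).  For each node of `F`, in the order in which they become active,
this lists the coordinates of the successors of that node, from left to right.
The root of the leftmost tree of `F` carries the exponent `j` plus its number of right siblings;
thus the exponent of a node is the number of cane paths that start in it. -/
def successorCoords : PlaneForest → ℕ → ℕ → List (List (ℕ × ℕ))
  | nil, _, _ => []
  | cons C R, p, j =>
      siblings p (j + R.numTrees) C.numTrees ::
        (C.successorCoords (p + C.numTrees) (j + R.numTrees) ++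
          R.successorCoords (p + C.numNodes) j)

end PlaneForest

/-! ### Polytopes -/

/-- The entry with index `i` of a vector, as a function on `ℕ` (zero out of range). -/
def entry {n : ℕ} (x : Fin n → ℝ) (i : ℕ) : ℝ := if h : i < n then x ⟨i, h⟩ else 0

/-- The product `P × Q ⊆ ℝ^(a+b)` of `P ⊆ ℝ^a` and `Q ⊆ ℝ^b`. -/
def prodSet {a b : ℕ} (P : Set (Fin a → ℝ)) (Q : Set (Fin b → ℝ)) : Set (Fin (a + b) → ℝ) :=
  {x | (fun i => x (Fin.castAdd b i)) ∈ P ∧ (fun i => x (Fin.natAdd a i)) ∈ Q}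

/-- `cone(P) = {(x₀, x₁, …, xₙ) : 0 ≤ x₀ ≤ 1, (x₁, …, xₙ) ∈ x₀ P}`. -/
def coneSet {n : ℕ} (P : Set (Fin n → ℝ)) : Set (Fin (n + 1) → ℝ) :=
  {x | 0 ≤ x 0 ∧ x 0 ≤ 1 ∧ ∃ y ∈ P, Fin.tail x = x 0 • y}

/-- The polytope `D_T(t)` of the plane tree `T` whose forest of subtrees at the root is `C`:
for each node of `T` with successors `v₁, …, vₖ` (from left to right) carrying the coordinates
`c₁, …, cₖ`, it requires `1 ≤ c₁ ≤ … ≤ cₖ ≤ 1 + t`. -/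
def treePolytope (t : ℝ) (C : PlaneForest) : Set (Fin C.numNodes → ℝ) :=
  {x | ∀ L ∈ (PlaneForest.cons C .nil).successorCoords 0 0,
    ((1 :: L.map fun c => entry x c.1 / (1 + t) ^ c.2) ++ [1 + t]).IsChain (· ≤ ·)}

/-- The dimension of the space in which the polytope of a plane forest lives. -/
def PlaneForest.dim : PlaneForest → ℕ
  | .nil => 0
  | .cons C .nil => C.numNodes
  | .cons C (.cons C' R) => C.numNodes + ((PlaneForest.cons C' R).dim + 1)

/-- `D_F(t) = D_{T₁}(t) × cone(D_{T₂}(t) × cone(D_{T₃}(t) × ⋯))`, where `T₁, T₂, …` are the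
components of `F` (the value at the empty forest is irrelevant). -/
def forestPolytopeAux (t : ℝ) : (F : PlaneForest) → Set (Fin F.dim → ℝ)
  | .nil => Set.univ
  | .cons C .nil => treePolytope t C
  | .cons C (.cons C' R) =>
      prodSet (treePolytope t C) (coneSet (forestPolytopeAux t (.cons C' R)))

/-- Plane forests on `N` nodes. -/
abbrev PlaneForestOn (N : ℕ) : Type := {F : PlaneForest // F.numNodes = N}

theorem PlaneForest.dim_succ : (C R : PlaneForest) →
    (PlaneForest.cons C R).dim + 1 = (PlaneForest.cons C R).numNodes
  | C, .nil => by simp [PlaneForest.dim, PlaneForest.numNodes]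
  | C, .cons C' R => by
      have h := PlaneForest.dim_succ C' R
      simp only [PlaneForest.dim, PlaneForest.numNodes] at h ⊢
      omega

theorem PlaneForestOn.dim_eq {n : ℕ} (F : PlaneForestOn (n + 1)) : F.1.dim = n := by
  obtain ⟨F, hF⟩ := F
  cases F with
  | nil => simp [PlaneForest.numNodes] at hF
  | cons C R =>
      have h := PlaneForest.dim_succ C R
      simp only at hF ⊢
      omega

/-- The polytope `D_F(t) ⊆ ℝⁿ` of a plane forest on `n + 1` nodes. -/
def forestPolytope {n : ℕ} (t : ℝ) (F : PlaneForestOn (n + 1)) : Set (Fin n → ℝ) :=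
  {x | (fun i => x (Fin.cast F.dim_eq i)) ∈ forestPolytopeAux t F.1}

/-- The `t`-Gayley polytope: `0 ≤ xᵢ ≤ (1 + t) xᵢ₋₁` for `i = 1, …, n`, where `x₀ = 1`. -/
def gayleyPolytope (n : ℕ) (t : ℝ) : Set (Fin n → ℝ) :=
  {x | ∀ i : Fin n, 0 ≤ x i ∧
    x i ≤ (1 + t) * (Fin.cons 1 x : Fin (n + 1) → ℝ) i.castSucc}

/-- A bounded polytope: a bounded set given by finitely many weak linear inequalities. -/
def IsBoundedPolytope {n : ℕ} (P : Set (Fin n → ℝ)) : Prop :=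
  (∃ (k : ℕ) (A : Matrix (Fin k) (Fin n) ℝ) (b : Fin k → ℝ), P = {x | ∀ i, (A.mulVec x) i ≤ b i}) ∧
    Bornology.IsBounded P

/-- The polytopes `D i` form a (polytopal) subdivision of `P`: there are finitely many of them,
they cover exactly `P`, they have pairwise disjoint interiors, and the intersection of any two of
them is a (possibly empty) face of both. -/
structure IsSubdivision {n : ℕ} {ι : Type} (P : Set (Fin n → ℝ)) (D : ι → Set (Fin n → ℝ)) :
    Prop where
  finite : Finite ι
  polytope : ∀ i, IsBoundedPolytope (D i)
  cover : ⋃ i, D i = P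
  disjoint_interior : ∀ i j, i ≠ j → Disjoint (interior (D i)) (interior (D j))
  inter_face : ∀ i j, IsExposed ℝ (D i) (D i ∩ D j) ∧ IsExposed ℝ (D j) (D i ∩ D j)

/-! ### Neighbors-first search -/

/-- Rooted ordered forests with labeled nodes; same shape as plane forests. -/
inductive LabeledForest (V : Type) : Type
  | nil : LabeledForest V
  | cons (root : V) (children rest : LabeledForest V) : LabeledForest V

namespace LabeledForest

/-- Juxtaposition. -/
def append {V : Type} : LabeledForest V → LabeledForest V → LabeledForest V
  | nil, G => G
  | cons v C R, G => cons v C (R.append G)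

/-- Delete the labels. -/
def erase {V : Type} : LabeledForest V → PlaneForest
  | nil => .nil
  | cons _ C R => .cons C.erase R.erase

end LabeledForest

section NFS

variable {V : Type} [LinearOrder V] [Fintype V] (adj : V → V → Prop) [DecidableRel adj]

/-- Neighbors-first search.  The list contains visited nodes that have not been active yet, the
last visited one first, and `U` is the set of unvisited nodes.  The first node `v` of the list
becomes active; its unvisited neighbors are visited in decreasing order of their labels, so that
the one with the smallest label becomes active next; once everything below `v` is finished, the
search backtracks to the last visited node that has not been active.  Returned are the part of the
search forest below the nodes of the list (subtrees ordered by increasing labels of their roots)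
and the set of nodes that remain unvisited.  The first argument bounds the depth of the recursion;
any number that is at least the number of nodes in the list and in `U` gives the same result. -/
def nfsExplore : ℕ → List V → Finset V → LabeledForest V × Finset V
  | 0, _, U => (.nil, U)
  | _ + 1, [], U => (.nil, U)
  | k + 1, v :: L, U =>
      let N := U.filter (adj v)
      let below := nfsExplore k (N.sort (· ≤ ·)) (U \ N)
      let next := nfsExplore k L below.2
      (.cons v below.1 next.1, next.2)

/-- Search the components that meet the set `U` of unvisited nodes, in decreasing order of their
maximal labels, each starting from its node of maximal label. -/
def nfsComponents : ℕ → Finset V → LabeledForest V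
  | 0, _ => .nil
  | k + 1, U =>
      if h : U.Nonempty then
        let r := nfsExplore adj (Fintype.card V) [U.max' h] (U.erase (U.max' h))
        r.1.append (nfsComponents k r.2)
      else .nil

/-- The search forest of the neighbors-first search. -/
def nfsForest : LabeledForest V := nfsComponents adj (Fintype.card V) Finset.univ

end NFS

open Classical in
/-- `Φ(G)`: the labeled forest that is the output of the neighbors-first search on `G`. -/
noncomputable def graphPhi {N : ℕ} (G : SimpleGraph (Fin N)) : LabeledForest (Fin N) :=
  nfsForest G.Adj

/-- `Ψ(G)`: the plane forest obtained from `Φ(G)` by deleting the labels. -/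
noncomputable def graphPsi {N : ℕ} (G : SimpleGraph (Fin N)) : PlaneForest := (graphPhi G).erase

open Classical in
/-- `∑ t^{|E(G)|}` over the graphs `G` on `N` labeled nodes that satisfy `p`. -/
noncomputable def edgeGenFun {N : ℕ} (t : ℝ) (p : SimpleGraph (Fin N) → Prop) : ℝ :=
  ∑ G : SimpleGraph (Fin N) with p G, t ^ G.edgeSet.ncard

/-! Both sides of the volume formula are computed independently and agree factor by factor.

Graphs. A run of the search asks, for each active node, which unvisited nodes are its neighbors.
Hence `Φ(G) = Φ` says exactly that the edges of `Φ` lie in `G` and that the pairs answered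
negatively do not; all other pairs are free (`LabeledForest.isSearched_iff`). If `x` is visited
before `y`, the pair is never asked about exactly when `x` is still waiting to become active at the
time `y` is visited, and the number of such `x` is the exponent of the coordinate of `y`. So every
labeling of `F` contributes `t` to the number of nonroots times `1 + t` to the sum of the exponents
(`forestQueries_add_forestExp`). The admissible labelings number `n!` divided by the factorials of
the degrees and by the sizes of the proper final segments of components (`card_rootedLabelings`).

Volumes. The successors of one node run through a simplex of ordered coordinates, scaled by powers
of `1 + t`; different groups of siblings use different coordinates, and a cone divides the volume by
its dimension. This gives the same factors (`volume_forestPolytopeAux`).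

Subdivision. Put `q = 1 + t`. Read a point of the Gayley polytope from left to right and give each
coordinate as depth the least `a` with `xᵢ ≤ q ^ a * x_ρ`, where `ρ` is the last coordinate of depth
`0`. Since `xᵢ ≤ q * xᵢ₋₁`, the depth grows by at most one per step, and sequences with this
property correspond to plane forests (`depths_injective`, `exists_depths_eq`). The polytope of `F`
is the closed region whose depth sequence is that of `F` (`mem_forestPolytope_iff`), so the
polytopes cover. At the first position where two depth sequences differ, the common points satisfy a
linear equation; adding up such equations over all positions gives a functional exposing the
intersection (`exists_depthIneq_functional`). Overlaps are null, and summing over `F` yields the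
total volume. -/

theorem choose_two_add (a b : ℕ) : (a + b).choose 2 = a.choose 2 + b.choose 2 + a * b := by
  induction b with
  | zero => simp
  | succ b ih =>
    rw [← add_assoc, Nat.choose_succ_succ' (a + b) 1, Nat.choose_succ_succ' b 1, ih]
    simp only [Nat.choose_one_right]
    ring

/-! ### Queries, exponents and reduced degree sequences -/

namespace PlaneForest

/-- The number of nodes that are not roots. -/
def numNonroot : PlaneForest → ℕ
  | nil => 0
  | cons C R => C.numNodes + R.numNonroot

theorem numNodes_eq (F : PlaneForest) : F.numNodes = F.numTrees + F.numNonroot := by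
  induction F with
  | nil => rfl
  | cons C R _ ihR => simp only [numNodes, numTrees, numNonroot, ihR]; omega

/-- The sum of the exponents of all coordinates in `F.successorCoords p j`. -/
def expSum : PlaneForest → ℕ → ℕ
  | nil, _ => 0
  | cons C R, j => C.numTrees * (j + R.numTrees) + C.numTrees.choose 2 +
      C.expSum (j + R.numTrees) + R.expSum j

/-- The sum of the exponents of all coordinates, over all components. -/
def forestExp : PlaneForest → ℕ
  | nil => 0
  | cons C R => (cons C nil).expSum 0 + R.forestExp

/-- The number of adjacency queries of a search that has `u` unvisited nodes at the start and
produces a forest of the given shape. -/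
def queries : PlaneForest → ℕ → ℕ
  | nil, _ => 0
  | cons C R, u => u + C.queries (u - C.numTrees) + R.queries (u - C.numNodes)

/-- The number of adjacency queries of the search of all components. -/
def forestQueries : PlaneForest → ℕ
  | nil => 0
  | cons C R => (cons C nil).queries (C.numNodes + R.numNodes) + R.forestQueries

/-- The product of the factorials of the degrees. -/
def degFact : PlaneForest → ℕ
  | nil => 1
  | cons C R => C.numTrees ! * C.degFact * R.degFact

/-- The product of the numbers of nodes of the proper final segments of the list of components. -/
def tailProd : PlaneForest → ℕ
  | nil => 1
  | cons _ nil => 1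
  | cons _ (cons C R) => (cons C R).numNodes * (cons C R).tailProd

theorem degFact_pos (F : PlaneForest) : 0 < F.degFact := by
  induction F with
  | nil => simp [degFact]
  | cons C R ihC ihR => simp only [degFact]; positivity

theorem tailProd_pos : (F : PlaneForest) → 0 < F.tailProd
  | nil => by simp [tailProd]
  | cons _ nil => by simp [tailProd]
  | cons _ (cons C R) => by
    have := tailProd_pos (cons C R)
    have h : 0 < (cons C R).numNodes := by simp only [numNodes]; omega
    simp only [tailProd]; positivity

/-- A count of pairs. If `x` is visited before `y`, either `x` becomes active while `y` is
unvisited, and the pair is queried, or `x` is still waiting when `y` is visited, and the pair adds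
one to the exponent of `y`. The right side counts the pairs root–nonroot and nonroot–nonroot; `j`
further nodes wait throughout, and `u` nodes outside `F` are queried by every node of `F`. -/
theorem queries_add_expSum (F : PlaneForest) (u j : ℕ) :
    F.queries (F.numNonroot + u) + F.expSum j =
      F.numNonroot * (F.numTrees + j) + F.numNonroot.choose 2 +
        (F.numTrees + F.numNonroot) * u := by
  induction F generalizing u j with
  | nil => simp [queries, expSum, numNonroot, numTrees]
  | cons C R ihC ihR =>
    have h1 := ihC (R.numNonroot + u) (j + R.numTrees)
    have h2 := ihR u j
    have e1 : C.numNodes + R.numNonroot + u - C.numTrees = C.numNonroot + (R.numNonroot + u) := by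
      rw [numNodes_eq C]; omega
    have e2 : C.numNodes + R.numNonroot + u - C.numNodes = R.numNonroot + u := by omega
    simp only [queries, expSum, numNonroot, numTrees, e1, e2]
    rw [numNodes_eq C, choose_two_add, choose_two_add]
    linear_combination h1 + h2

/-- Pairs in different components are all queried, because each node of the earlier component asks
about every node not yet visited. Thus the exponents count exactly the pairs the search leaves open.
-/
theorem forestQueries_add_forestExp (F : PlaneForest) :
    F.forestQueries + F.forestExp = F.numNodes.choose 2 := by
  induction F with
  | nil => rfl
  | cons C R _ ihR =>
    have h := queries_add_expSum (cons C nil) R.numNodes 0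
    simp only [numNonroot, numTrees, add_zero, zero_add] at h
    simp only [forestQueries, forestExp, numNodes]
    rw [choose_two_add, choose_two_add, ← ihR]
    simp only [Nat.choose_eq_zero_of_lt (show 1 < 2 by norm_num)]
    linear_combination h

end PlaneForest

/-- The sum of `(i + 1) dᵢ` over the entries of a list, indexed from `0`. -/
def weightedSum : List ℕ → ℕ
  | [] => 0
  | d :: l => d + l.sum + weightedSum l

theorem weightedSum_append (a b : List ℕ) :
    weightedSum (a ++ b) = weightedSum a + weightedSum b + a.length * b.sum := by
  induction a with
  | nil => simp [weightedSum]
  | cons d l ih => simp only [List.cons_append, weightedSum, ih, List.sum_append,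
      List.length_cons]; ring

theorem sum_get_eq_weightedSum (l : List ℕ) :
    (∑ i : Fin l.length, ((i : ℤ) + 1) * (l.get i : ℤ)) = weightedSum l := by
  induction l with
  | nil => simp [weightedSum]
  | cons d l ih =>
    have hs : (∑ i : Fin l.length, (l.get i : ℤ)) = (l.sum : ℤ) := by
      simp [List.get_eq_getElem]
    have h : ∀ i : Fin l.length, (((i : ℕ) : ℤ) + 1 + 1) * (l.get i : ℤ) =
        ((i : ℤ) + 1) * (l.get i : ℤ) + l.get i := fun i => by ring
    refine (Fin.sum_univ_succ (n := l.length) _).trans ?_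
    have h' : ∀ i : Fin l.length, (((i.succ : Fin (l.length + 1)) : ℕ) : ℤ) = (i : ℕ) + 1 :=
      fun i => by simp
    change _ + ∑ i : Fin l.length, ((((i.succ : Fin (l.length + 1)) : ℕ) : ℤ) + 1) *
      (l.get i : ℤ) = _
    simp only [h', h, Finset.sum_add_distrib, ih, hs, weightedSum]
    simp; ring

namespace PlaneForest

theorem length_degSeq (F : PlaneForest) : F.degSeq.length = F.numNodes := by
  induction F with
  | nil => rfl
  | cons C R ihC ihR => simp [degSeq, numNodes, ihC, ihR]; omega

theorem sum_degSeq (F : PlaneForest) : F.degSeq.sum = F.numNonroot := by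
  induction F with
  | nil => rfl
  | cons C R ihC ihR =>
    simp only [degSeq, List.cons_append, List.sum_cons, List.sum_append, ihC, ihR, numNonroot,
      numNodes_eq C]
    omega

/-- The last node in depth-first order is a leaf. Erasing its zero therefore changes neither sums
nor products of factorials, only the positions of later components. -/
theorem dropLast_degSeq_append (C : PlaneForest) :
    (C.numTrees :: C.degSeq).dropLast ++ [0] = C.numTrees :: C.degSeq := by
  have key : ∀ C : PlaneForest, (C.numTrees :: C.degSeq).getLast (by simp) = 0 := by
    intro C
    induction C with
    | nil => rfl
    | cons C R ihC ihR =>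
      simp only [degSeq]
      cases R with
      | nil => simpa [degSeq] using ihC
      | cons C' R' =>
        have h : (cons C' R').degSeq ≠ [] := by simp [degSeq]
        rw [List.getLast_cons (by simp), List.getLast_append_of_ne_nil _ h]
        rwa [List.getLast_cons h] at ihR
  have := List.dropLast_append_getLast (l := C.numTrees :: C.degSeq) (by simp)
  rwa [key] at this

theorem length_dropLast_degSeq (C : PlaneForest) :
    (C.numTrees :: C.degSeq).dropLast.length = C.numNodes := by
  simp [length_degSeq]

theorem sum_dropLast_degSeq (C : PlaneForest) :
    (C.numTrees :: C.degSeq).dropLast.sum = C.numNodes := by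
  have := congrArg List.sum (dropLast_degSeq_append C)
  simp only [List.sum_append, List.sum_cons, List.sum_nil, add_zero, sum_degSeq] at this
  rw [this, numNodes_eq]

theorem weightedSum_dropLast_degSeq (C : PlaneForest) :
    weightedSum (C.numTrees :: C.degSeq).dropLast = weightedSum (C.numTrees :: C.degSeq) := by
  have := congrArg weightedSum (dropLast_degSeq_append C)
  simpa [weightedSum_append, weightedSum] using this

theorem prod_dropLast_degSeq (C : PlaneForest) :
    ((C.numTrees :: C.degSeq).dropLast.map Nat.factorial).prod =
      ((C.numTrees :: C.degSeq).map Nat.factorial).prod := by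
  have := congrArg (fun l => (l.map Nat.factorial).prod) (dropLast_degSeq_append C)
  simpa using this

theorem prod_degSeq (F : PlaneForest) : (F.degSeq.map Nat.factorial).prod = F.degFact := by
  induction F with
  | nil => rfl
  | cons C R ihC ihR => simp [degSeq, degFact, ihC, ihR, mul_assoc]

theorem prod_redDegSeq (F : PlaneForest) :
    (F.redDegSeq.map Nat.factorial).prod = F.degFact := by
  induction F with
  | nil => rfl
  | cons C R _ ihR =>
    simp only [redDegSeq, degFact, List.map_append, List.prod_append, ihR, prod_dropLast_degSeq,
      List.map_cons, List.prod_cons, prod_degSeq]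

theorem sum_redDegSeq (F : PlaneForest) : F.redDegSeq.sum = F.numNonroot := by
  induction F with
  | nil => rfl
  | cons C R _ ihR =>
    simp only [redDegSeq, List.sum_append, ihR, sum_dropLast_degSeq, numNonroot]

/-- When the `i`-th node becomes active, `F.numTrees + d₁ + ⋯ + dᵢ₋₁` nodes of `F` have been visited
and `i` of them have been active, so its rightmost successor has exponent `j + F.numTrees + d₁ + ⋯ +
dᵢ₋₁ - i`. Adding `i` to the exponents of its successors turns all exponents together into
consecutive integers starting at `j + F.numTrees`. -/
theorem expSum_add_weightedSum (F : PlaneForest) (j : ℕ) :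
    F.expSum j + weightedSum F.degSeq = (j + F.numTrees) * F.numNonroot +
      F.numNonroot.choose 2 := by
  induction F generalizing j with
  | nil => rfl
  | cons C R ihC ihR =>
    have h1 := ihC (j + R.numTrees)
    have h2 := ihR j
    simp only [expSum, degSeq, numTrees, numNonroot, List.cons_append, weightedSum,
      weightedSum_append, List.sum_append, sum_degSeq, length_degSeq]
    rw [numNodes_eq C, choose_two_add, choose_two_add]
    linear_combination h1 + h2

/-- In the reduced sequence a component fills as many places as it has nonroots, which is also the
sum of its degrees. The shift of positions in the later components is then precisely the mixed term
of `choose_two_add`. -/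
theorem forestExp_add_weightedSum (F : PlaneForest) :
    F.forestExp + weightedSum F.redDegSeq = (F.numNonroot + 1).choose 2 := by
  induction F with
  | nil => rfl
  | cons C R _ ihR =>
    have h := expSum_add_weightedSum (cons C nil) 0
    simp only [degSeq, List.append_nil, numTrees, numNonroot, add_zero] at h
    simp only [forestExp, redDegSeq, numNonroot, weightedSum_append, length_dropLast_degSeq,
      sum_redDegSeq, weightedSum_dropLast_degSeq]
    rw [add_assoc C.numNodes, choose_two_add, ← ihR]
    linear_combination h

theorem sum_treeSizes (F : PlaneForest) : F.treeSizes.sum = F.numNodes := by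
  induction F with
  | nil => rfl
  | cons C R _ ihR => simp [treeSizes, numNodes, ihR]

theorem prod_Ico_treeSizes : (F : PlaneForest) →
    ∏ j ∈ Finset.Ico 1 F.numTrees, (F.treeSizes.drop j).sum = F.tailProd
  | nil => by simp [numTrees, tailProd]
  | cons _ nil => by simp [numTrees, tailProd]
  | cons C (cons C' R) => by
    have ih := prod_Ico_treeSizes (cons C' R)
    rw [tailProd, ← ih, ← sum_treeSizes]
    rw [Finset.prod_eq_prod_Ico_succ_bot (by simp [numTrees])]
    congr 1
    rw [show (cons C (cons C' R)).numTrees = (cons C' R).numTrees + 1 from rfl,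
      ← Finset.prod_Ico_add' _ 1 _ 1]
    rfl

end PlaneForest

/-! ### The neighbors-first search as a relation between forests and graphs -/

namespace LabeledForest

variable {V : Type}

/-- The labels of the roots, from left to right. -/
def roots : LabeledForest V → List V
  | nil => []
  | cons v _ R => v :: R.roots

theorem length_roots (Φ : LabeledForest V) : Φ.roots.length = Φ.erase.numTrees := by
  induction Φ with
  | nil => rfl
  | cons v C R _ ihR => simp [roots, erase, PlaneForest.numTrees, ihR]

variable [LinearOrder V]

/-- The set of the labels of all nodes that are not roots. -/
def nonroots : LabeledForest V → Finset V
  | nil => ∅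
  | cons _ C R => C.roots.toFinset ∪ C.nonroots ∪ R.nonroots

/-- `Φ` is the part of the search forest below its roots when `U` is the set of unvisited nodes. -/
def IsExplored (adj : V → V → Prop) [DecidableRel adj] : LabeledForest V → Finset V → Prop
  | nil, _ => True
  | cons v C R, U => C.roots = (U.filter (adj v)).sort (· ≤ ·) ∧
      C.IsExplored adj (U \ C.roots.toFinset) ∧
      R.IsExplored adj (U \ (C.roots.toFinset ∪ C.nonroots))

/-- `Φ` is the search forest of the components on the set `U`. -/
def IsSearched (adj : V → V → Prop) [DecidableRel adj] : LabeledForest V → Finset V → Prop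
  | nil, U => U = ∅
  | cons v C R, U => ∃ h : U.Nonempty, v = U.max' h ∧
      (cons v C nil).IsExplored adj (U.erase v) ∧
      R.IsSearched adj (U.erase v \ (cons v C nil).nonroots)

/-- The active node and the unvisited set determine the list of successors, and with it both
unvisited sets passed on to the recursion. -/
theorem IsExplored.unique {adj : V → V → Prop} [DecidableRel adj] {Φ Φ' : LabeledForest V}
    {U : Finset V} (h : Φ.IsExplored adj U) (h' : Φ'.IsExplored adj U)
    (hr : Φ.roots = Φ'.roots) : Φ = Φ' := by
  induction Φ generalizing Φ' U with
  | nil =>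
    cases Φ' with
    | nil => rfl
    | cons v C R => simp [roots] at hr
  | cons v C R ihC ihR =>
    cases Φ' with
    | nil => simp [roots] at hr
    | cons v' C' R' =>
      simp only [roots, List.cons.injEq] at hr
      obtain ⟨rfl, hr⟩ := hr
      obtain ⟨h1, h2, h3⟩ := h
      obtain ⟨h1', h2', h3'⟩ := h'
      have hC : C.roots = C'.roots := h1.trans h1'.symm
      obtain rfl := ihC h2 (hC ▸ h2') hC
      obtain rfl := ihR h3 h3' hr
      rfl

theorem IsSearched.unique {adj : V → V → Prop} [DecidableRel adj] {Φ Φ' : LabeledForest V}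
    {U : Finset V} (h : Φ.IsSearched adj U) (h' : Φ'.IsSearched adj U) : Φ = Φ' := by
  induction Φ generalizing Φ' U with
  | nil =>
    cases Φ' with
    | nil => rfl
    | cons v C R =>
      obtain ⟨hU, -⟩ := h'
      simp only [IsSearched] at h
      simp [h] at hU
  | cons v C R _ ihR =>
    cases Φ' with
    | nil =>
      obtain ⟨hU, -⟩ := h
      simp only [IsSearched] at h'
      simp [h'] at hU
    | cons v' C' R' =>
      obtain ⟨hU, rfl, h1, h2⟩ := h
      obtain ⟨hU', rfl, h1', h2'⟩ := h'
      have h3 := h1.unique h1' rfl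
      simp only [cons.injEq, true_and, and_true] at h3
      subst h3
      rw [ihR h2 h2']

end LabeledForest

section Spec

variable {V : Type} [LinearOrder V] (adj : V → V → Prop) [DecidableRel adj]

/-- The recursion bound is large enough because a step uses up the active node, while visiting its
neighbors only moves nodes from `U` to the list. -/
theorem nfsExplore_spec (k : ℕ) (L : List V) (U : Finset V) (hk : L.length + U.card ≤ k) :
    (nfsExplore adj k L U).1.roots = L ∧ (nfsExplore adj k L U).1.IsExplored adj U ∧
      (nfsExplore adj k L U).2 = U \ (nfsExplore adj k L U).1.nonroots := by
  induction k generalizing L U with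
  | zero =>
    have : L = [] := List.eq_nil_of_length_eq_zero (by omega)
    subst this
    simp [nfsExplore, LabeledForest.roots, LabeledForest.IsExplored, LabeledForest.nonroots]
  | succ k ih =>
    cases L with
    | nil => simp [nfsExplore, LabeledForest.roots, LabeledForest.IsExplored, LabeledForest.nonroots]
    | cons v L =>
      simp only [List.length_cons] at hk
      simp only [nfsExplore]
      set N := U.filter (adj v) with hN
      have hNU : N ⊆ U := Finset.filter_subset _ _
      obtain ⟨b1, b2, b3⟩ := ih (N.sort (· ≤ ·)) (U \ N) (by
        rw [Finset.length_sort, Finset.card_sdiff_of_subset hNU]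
        have := Finset.card_le_card hNU
        omega)
      set B := nfsExplore adj k (N.sort (· ≤ ·)) (U \ N)
      have hB : B.2 ⊆ U := by
        rw [b3]; exact Finset.sdiff_subset.trans Finset.sdiff_subset
      obtain ⟨c1, c2, c3⟩ := ih L B.2 (by have := Finset.card_le_card hB; omega)
      have hr : B.1.roots.toFinset = N := by rw [b1, Finset.sort_toFinset]
      have e : U \ (B.1.roots.toFinset ∪ B.1.nonroots) = B.2 := by
        rw [hr, b3, Finset.sdiff_union_distrib, ← Finset.inf_eq_inter]
        ext; simp; tauto
      refine ⟨?_, ⟨b1, ?_, ?_⟩, ?_⟩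
      · simp [LabeledForest.roots, c1]
      · rwa [hr]
      · rwa [e]
      · simp only [LabeledForest.nonroots]
        rw [c3, ← e]
        ext; simp; tauto

variable [Fintype V]

theorem nfsComponents_spec (k : ℕ) (U : Finset V) (hk : U.card ≤ k) :
    (nfsComponents adj k U).IsSearched adj U := by
  induction k generalizing U with
  | zero =>
    have : U = ∅ := Finset.card_eq_zero.1 (by omega)
    simp [nfsComponents, LabeledForest.IsSearched, this]
  | succ k ih =>
    by_cases h : U.Nonempty
    · simp only [nfsComponents, dif_pos h]
      have hm := U.max'_mem h
      have hc := Finset.card_erase_of_mem hm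
      have hpos := h.card_pos
      -- The start node and the other nodes of `U` number at most `Fintype.card V`, so this bound is
      -- admissible.
      obtain ⟨b1, b2, b3⟩ := nfsExplore_spec adj (Fintype.card V) [U.max' h]
        (U.erase (U.max' h)) (by
          have := Finset.card_le_univ U
          simp only [List.length_singleton]; omega)
      set B := nfsExplore adj (Fintype.card V) [U.max' h] (U.erase (U.max' h))
      rcases hB : B.1 with _ | ⟨v, C, R⟩
      · simp [hB, LabeledForest.roots] at b1
      · rw [hB] at b1 b2 b3
        simp only [LabeledForest.roots, List.cons.injEq] at b1
        obtain ⟨rfl, hR⟩ := b1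
        rcases R with _ | ⟨w, C', R'⟩
        · refine ⟨h, rfl, b2, ?_⟩
          rw [← b3]
          refine ih _ ?_
          have := Finset.card_le_card (b3.le.trans Finset.sdiff_subset)
          omega
        · simp [LabeledForest.roots] at hR
    · simp only [nfsComponents, dif_neg h, LabeledForest.IsSearched]
      exact Finset.not_nonempty_iff_eq_empty.1 h

/-- Replaces the algorithm by a condition on `Φ` alone, which can then be read as a list of required
edges and non-edges. -/
theorem nfsForest_eq_iff (Φ : LabeledForest V) :
    nfsForest adj = Φ ↔ Φ.IsSearched adj Finset.univ := by
  have h := nfsComponents_spec adj (Fintype.card V) Finset.univ (Finset.card_le_univ _)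
  exact ⟨fun e => e ▸ h, fun h' => h.unique h'⟩

end Spec

/-! ### Counting the labelings of a plane forest -/

section Labelings

variable {V : Type} [LinearOrder V]

open Classical in
/-- The labelings of `F` with root labels `L`, the other labels from `U`, and siblings that are
not roots in increasing order. -/
noncomputable def PlaneForest.labelings :
    PlaneForest → List V → Finset V → Finset (LabeledForest V)
  | .nil, [], _ => {.nil}
  | .nil, _ :: _, _ => ∅
  | .cons _ _, [], _ => ∅
  | .cons C R, v :: L, U => (U.powersetCard C.numTrees).biUnion fun N =>
      (C.labelings (N.sort (· ≤ ·)) (U \ N)).biUnion fun Φ =>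
        (R.labelings L (U \ (N ∪ Φ.nonroots))).image (.cons v Φ)

open Classical in
/-- The labelings of `F` by `U` in which siblings that are not roots are in increasing order,
each root has the maximal label of its component, and the roots are in decreasing order. -/
noncomputable def PlaneForest.rootedLabelings :
    PlaneForest → Finset V → Finset (LabeledForest V)
  | .nil, U => if U = ∅ then {.nil} else ∅
  | .cons C R, U => if h : U.Nonempty then
      ((PlaneForest.cons C .nil).labelings [U.max' h] (U.erase (U.max' h))).biUnion fun Φ =>
        (R.rootedLabelings (U.erase (U.max' h) \ Φ.nonroots)).image Φ.append
      else ∅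

theorem PlaneForest.mem_labelings_cons {C R : PlaneForest} {L : List V} {U : Finset V}
    {Φ : LabeledForest V} (h : Φ ∈ (PlaneForest.cons C R).labelings L U) :
    ∃ v L' A B, L = v :: L' ∧ Φ = .cons v A B ∧ A.roots.toFinset ⊆ U ∧
      A.roots.toFinset.card = C.numTrees ∧ A.roots = A.roots.toFinset.sort (· ≤ ·) ∧
      A ∈ C.labelings A.roots (U \ A.roots.toFinset) ∧
      B ∈ R.labelings L' (U \ (A.roots.toFinset ∪ A.nonroots)) := by
  have hroots : ∀ (F : PlaneForest) (L : List V) (U : Finset V) (Φ : LabeledForest V),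
      Φ ∈ F.labelings L U → Φ.roots = L := by
    intro F
    induction F with
    | nil => intro L U Φ h; cases L <;> simp_all [PlaneForest.labelings, LabeledForest.roots]
    | cons C R _ ihR =>
      intro L U Φ h
      cases L with
      | nil => simp [PlaneForest.labelings] at h
      | cons v L =>
        simp only [PlaneForest.labelings, Finset.mem_biUnion, Finset.mem_image] at h
        obtain ⟨N, -, A, -, B, hB, rfl⟩ := h
        simp [LabeledForest.roots, ihR _ _ _ hB]
  cases L with
  | nil => simp [PlaneForest.labelings] at h
  | cons v L =>
    simp only [PlaneForest.labelings, Finset.mem_biUnion, Finset.mem_image,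
      Finset.mem_powersetCard] at h
    obtain ⟨N, ⟨hNU, hNc⟩, A, hA, B, hB, rfl⟩ := h
    have hr := hroots _ _ _ _ hA
    have hN : A.roots.toFinset = N := by rw [hr, Finset.sort_toFinset]
    exact ⟨v, L, A, B, rfl, rfl, by rwa [hN], by rwa [hN], by rw [hN, hr], by rwa [hN, hr],
      by rwa [hN]⟩

theorem PlaneForest.mem_labelings {F : PlaneForest} {L : List V} {U : Finset V}
    {Φ : LabeledForest V} (h : Φ ∈ F.labelings L U) :
    Φ.roots = L ∧ Φ.erase = F ∧ Φ.nonroots ⊆ U ∧ Φ.nonroots.card = F.numNonroot := by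
  induction F generalizing L U Φ with
  | nil =>
    cases L <;> simp_all [PlaneForest.labelings, LabeledForest.roots, LabeledForest.nonroots,
      LabeledForest.erase, PlaneForest.numNonroot]
  | cons C R ihC ihR =>
    obtain ⟨v, L', A, B, rfl, rfl, hU, hc, -, hA, hB⟩ := mem_labelings_cons h
    obtain ⟨-, a2, a3, a4⟩ := ihC hA
    obtain ⟨b1, b2, b3, b4⟩ := ihR hB
    refine ⟨by simp [LabeledForest.roots, b1], by simp [LabeledForest.erase, a2, b2], ?_, ?_⟩
    · simp only [LabeledForest.nonroots]
      exact Finset.union_subset (Finset.union_subset hU (a3.trans Finset.sdiff_subset))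
        (b3.trans Finset.sdiff_subset)
    · simp only [LabeledForest.nonroots]
      rw [Finset.card_union_of_disjoint, Finset.card_union_of_disjoint, hc, a4, b4,
        PlaneForest.numNonroot, numNodes_eq]
      · exact (Finset.disjoint_of_subset_left a3 Finset.sdiff_disjoint).symm
      · exact (Finset.disjoint_of_subset_left b3 Finset.sdiff_disjoint).symm

theorem LabeledForest.IsExplored.mem_labelings {adj : V → V → Prop} [DecidableRel adj]
    {Φ : LabeledForest V} {U : Finset V} (h : Φ.IsExplored adj U) :
    Φ ∈ Φ.erase.labelings Φ.roots U := by
  induction Φ generalizing U with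
  | nil => simp [LabeledForest.erase, LabeledForest.roots, PlaneForest.labelings]
  | cons v A B ihA ihB =>
    obtain ⟨h1, h2, h3⟩ := h
    simp only [LabeledForest.erase, LabeledForest.roots, PlaneForest.labelings,
      Finset.mem_biUnion, Finset.mem_image, Finset.mem_powersetCard]
    have hN : A.roots.toFinset = U.filter (adj v) := by rw [h1, Finset.sort_toFinset]
    refine ⟨A.roots.toFinset, ⟨hN ▸ Finset.filter_subset _ _, ?_⟩, A, ?_, B, ihB h3, rfl⟩
    · rw [hN, ← LabeledForest.length_roots, h1, Finset.length_sort]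
    · have := ihA h2
      rwa [hN, ← h1, ← hN]

theorem LabeledForest.IsSearched.mem_rootedLabelings {adj : V → V → Prop} [DecidableRel adj]
    {Φ : LabeledForest V} {U : Finset V} (h : Φ.IsSearched adj U) :
    Φ ∈ Φ.erase.rootedLabelings U := by
  induction Φ generalizing U with
  | nil =>
    simp only [LabeledForest.IsSearched] at h
    simp [LabeledForest.erase, PlaneForest.rootedLabelings, h]
  | cons v A B _ ihB =>
    obtain ⟨hU, rfl, h1, h2⟩ := h
    simp only [LabeledForest.erase, PlaneForest.rootedLabelings, dif_pos hU, Finset.mem_biUnion,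
      Finset.mem_image]
    exact ⟨_, h1.mem_labelings, B, ihB h2, rfl⟩

theorem LabeledForest.IsSearched.numNodes_erase {adj : V → V → Prop} [DecidableRel adj]
    {Φ : LabeledForest V} {U : Finset V} (h : Φ.IsSearched adj U) :
    Φ.erase.numNodes = U.card := by
  induction Φ generalizing U with
  | nil =>
    simp only [LabeledForest.IsSearched] at h
    simp [LabeledForest.erase, PlaneForest.numNodes, h]
  | cons v A B _ ihB =>
    obtain ⟨hU, rfl, h1, h2⟩ := h
    obtain ⟨-, -, c3, c4⟩ := PlaneForest.mem_labelings h1.mem_labelings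
    have h3 := ihB h2
    rw [Finset.card_sdiff_of_subset c3, c4, Finset.card_erase_of_mem (U.max'_mem hU)] at h3
    have h4 := Finset.card_le_card c3
    rw [c4, Finset.card_erase_of_mem (U.max'_mem hU)] at h4
    have := hU.card_pos
    simp only [LabeledForest.erase, PlaneForest.numNonroot, PlaneForest.numNodes] at h3 h4 ⊢
    omega

/-- Injective labelings of the nonroots from `U` number `(F.numNonroot + u)! / u !`, and prescribing
the order among siblings divides by the factorials of the degrees. In the induction, choosing the
label set of the successors gives the binomial coefficient. -/
theorem PlaneForest.card_labelings (F : PlaneForest) (L : List V) (U : Finset V) (u : ℕ)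
    (hL : L.length = F.numTrees) (hU : U.card = F.numNonroot + u) :
    (F.labelings L U).card * F.degFact * u ! = (F.numNonroot + u)! := by
  induction F generalizing L U u with
  | nil =>
    have : L = [] := List.eq_nil_of_length_eq_zero (by simpa [numTrees] using hL)
    subst this
    simp [labelings, degFact, numNonroot]
  | cons C R ihC ihR =>
    cases L with
    | nil => simp [numTrees] at hL
    | cons v L =>
      classical
      simp only [List.length_cons, numTrees, Nat.add_right_cancel_iff] at hL
      simp only [numNonroot] at hU
      have hA : ∀ N ∈ U.powersetCard C.numTrees, ∀ A ∈ C.labelings (N.sort (· ≤ ·)) (U \ N),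
          ((R.labelings L (U \ (N ∪ A.nonroots))).image (LabeledForest.cons v A)).card *
            (R.degFact * u !) = (R.numNonroot + u)! := by
        intro N hN A hA
        rw [Finset.mem_powersetCard] at hN
        obtain ⟨-, -, a3, a4⟩ := mem_labelings hA
        rw [Finset.card_image_of_injective _ (fun x y h => by simpa using h), ← mul_assoc]
        refine ihR _ _ _ hL ?_
        have hd : Disjoint N A.nonroots := (Finset.disjoint_of_subset_left a3
          Finset.sdiff_disjoint).symm
        rw [Finset.card_sdiff_of_subset (Finset.union_subset hN.1 (a3.trans
          Finset.sdiff_subset)), Finset.card_union_of_disjoint hd, a4, hN.2, hU, numNodes_eq C]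
        omega
      have hN : ∀ N ∈ U.powersetCard C.numTrees,
          ((C.labelings (N.sort (· ≤ ·)) (U \ N)).biUnion fun Φ =>
            (R.labelings L (U \ (N ∪ Φ.nonroots))).image (LabeledForest.cons v Φ)).card *
            (C.degFact * (R.degFact * u !)) = (C.numNonroot + (R.numNonroot + u))! := by
        intro N hN
        rw [Finset.card_biUnion, ← mul_assoc, mul_right_comm, Finset.sum_mul,
          Finset.sum_congr rfl (hA N hN), Finset.sum_const, smul_eq_mul, mul_right_comm]
        · rw [Finset.mem_powersetCard] at hN
          refine ihC _ _ _ (by rw [Finset.length_sort, hN.2]) ?_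
          rw [Finset.card_sdiff_of_subset hN.1, hN.2, hU, numNodes_eq C]
          omega
        · intro A _ A' _ hne
          rw [Function.onFun, Finset.disjoint_left]
          intro Φ h h'
          simp only [Finset.mem_image] at h h'
          obtain ⟨B, -, rfl⟩ := h
          obtain ⟨B', -, h'⟩ := h'
          simp only [LabeledForest.cons.injEq, true_and] at h'
          exact hne h'.1.symm
      simp only [labelings, degFact]
      rw [Finset.card_biUnion]
      · have e : ∀ s : ℕ, s * (C.numTrees ! * C.degFact * R.degFact) * u ! =
            s * (C.degFact * (R.degFact * u !)) * C.numTrees ! := fun s => by ring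
        rw [e, Finset.sum_mul, Finset.sum_congr rfl hN, Finset.sum_const, smul_eq_mul,
          Finset.card_powersetCard, hU, numNonroot]
        have := Nat.choose_mul_factorial_mul_factorial
          (show C.numTrees ≤ C.numNodes + R.numNonroot + u by rw [numNodes_eq C]; omega)
        rw [← this, numNodes_eq C, show C.numTrees + C.numNonroot + R.numNonroot + u - C.numTrees =
          C.numNonroot + (R.numNonroot + u) by omega]
        ring
      · intro N hN N' hN' hne
        rw [Function.onFun, Finset.disjoint_left]
        intro Φ h h'
        simp only [Finset.mem_biUnion, Finset.mem_image] at h h'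
        obtain ⟨A, hA, B, -, rfl⟩ := h
        obtain ⟨A', hA', B', -, h'⟩ := h'
        simp only [LabeledForest.cons.injEq, true_and] at h'
        obtain ⟨rfl, -⟩ := h'
        -- The chosen set `N` is recovered from the labeling as the set of root labels of its first
        -- subforest, so different choices give different labelings.
        apply hne
        have h1 := (mem_labelings hA).1
        have h2 := (mem_labelings hA').1
        rw [← Finset.sort_toFinset (s := N) (· ≤ ·), ← Finset.sort_toFinset (s := N') (· ≤ ·),
          ← h1, ← h2]

/-- One component is split off: its root label is forced to be the maximum of `U`, and the
`R.numNodes` labels it leaves over go to `R`. The numbers `w` and `r` keep the count for `R`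
abstract. -/
theorem PlaneForest.card_rootedLabelings_mul (C R : PlaneForest) (U : Finset V)
    (hU : U.card = (cons C R).numNodes) (w r : ℕ)
    (hr : ∀ U' : Finset V, U'.card = R.numNodes → (R.rootedLabelings U').card * w = r) :
    ((cons C R).rootedLabelings U).card * (cons C nil).degFact * R.numNodes ! * w =
      (C.numNodes + R.numNodes)! * r := by
  classical
  have hne : U.Nonempty := Finset.card_pos.1 (by rw [hU]; simp only [numNodes]; omega)
  have hE := Finset.card_erase_of_mem (U.max'_mem hne)
  simp only [numNodes] at hU
  have h := card_labelings (cons C nil) [U.max' hne] (U.erase (U.max' hne)) R.numNodes rfl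
    (by simp only [numNonroot]; omega)
  simp only [numNonroot, add_zero] at h
  simp only [rootedLabelings, dif_pos hne]
  rw [Finset.card_biUnion, mul_right_comm, mul_right_comm _ _ w, Finset.sum_mul, ← h,
    Finset.sum_congr rfl (g := fun _ => r), Finset.sum_const, smul_eq_mul]
  · ring
  · intro Φ hΦ
    obtain ⟨v, L, A, B, hL, rfl, -⟩ := mem_labelings_cons hΦ
    obtain ⟨h1, -, h3, h4⟩ := mem_labelings hΦ
    obtain rfl : B = .nil := by
      cases B with
      | nil => rfl
      | cons => simp [LabeledForest.roots] at h1
    rw [Finset.card_image_of_injective _ (fun x y h => by simpa [LabeledForest.append] using h)]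
    refine hr _ ?_
    rw [Finset.card_sdiff_of_subset h3, h4]
    simp only [numNonroot]; omega
  · intro Φ hΦ Φ' hΦ' hne'
    rw [Function.onFun, Finset.disjoint_left]
    intro Ψ h1 h2
    obtain ⟨v, L, A, B, -, rfl, -⟩ := mem_labelings_cons hΦ
    obtain ⟨v', L', A', B', -, rfl, -⟩ := mem_labelings_cons hΦ'
    have r1 := (mem_labelings hΦ).1
    have r2 := (mem_labelings hΦ').1
    cases B with
    | cons => simp [LabeledForest.roots] at r1
    | nil =>
      cases B' with
      | cons => simp [LabeledForest.roots] at r2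
      | nil =>
        simp only [Finset.mem_image] at h1 h2
        obtain ⟨X, -, rfl⟩ := h1
        obtain ⟨Y, -, hY⟩ := h2
        simp only [LabeledForest.append, LabeledForest.cons.injEq] at hY
        exact hne' (by rw [hY.1, hY.2.1])

/-- With `N` nodes in the remaining components, the first component contributes a denominator `N!`,
but the remaining labelings contribute only the numerator `(N - 1)!`, since their first root is
forced too. The quotient `N` is a factor of `tailProd`. -/
theorem PlaneForest.card_rootedLabelings (C R : PlaneForest) (U : Finset V)
    (hU : U.card = (cons C R).numNodes) :
    ((cons C R).rootedLabelings U).card * (cons C R).degFact * (cons C R).tailProd =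
      (C.numNodes + R.numNodes)! := by
  induction R generalizing C U with
  | nil =>
    have h := card_rootedLabelings_mul C nil U hU 1 1 (fun U' h => by
      simp only [numNodes, Finset.card_eq_zero] at h
      simp [rootedLabelings, h])
    simpa [numNodes, tailProd] using h
  | cons C' R _ ihR =>
    have h := card_rootedLabelings_mul C (cons C' R) U hU _ _ (fun U' h => by
      rw [← mul_assoc]; exact ihR C' U' h)
    have h0 : (cons C' R).numNodes ! = (cons C' R).numNodes * (C'.numNodes + R.numNodes)! := by
      rw [show (cons C' R).numNodes = C'.numNodes + R.numNodes + 1 by simp only [numNodes]; omega,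
        Nat.factorial_succ]
    rw [h0] at h
    refine Nat.eq_of_mul_eq_mul_right (Nat.factorial_pos (C'.numNodes + R.numNodes)) ?_
    rw [← h, tailProd]
    simp only [degFact]
    ring

end Labelings

/-! ### Edges and non-edges that determine the search -/

namespace LabeledForest

variable {V : Type} [LinearOrder V]

/-- The edges of a labeled forest. -/
def treeEdges : LabeledForest V → Finset (Sym2 V)
  | nil => ∅
  | cons v C R => C.roots.toFinset.image (s(v, ·)) ∪ C.treeEdges ∪ R.treeEdges

/-- The pairs that the search finds to be non-adjacent, when `U` is the set of unvisited nodes. -/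
def nonEdges : LabeledForest V → Finset V → Finset (Sym2 V)
  | nil, _ => ∅
  | cons v C R, U => (U \ C.roots.toFinset).image (s(v, ·)) ∪
      C.nonEdges (U \ C.roots.toFinset) ∪ R.nonEdges (U \ (C.roots.toFinset ∪ C.nonroots))

/-- The pairs that the search of all components finds to be non-adjacent. -/
def searchNonEdges : LabeledForest V → Finset V → Finset (Sym2 V)
  | nil, _ => ∅
  | cons v C R, U => (cons v C nil).nonEdges (U.erase v) ∪
      R.searchNonEdges (U.erase v \ (cons v C nil).nonroots)

end LabeledForest

open LabeledForest

section Queries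

variable {V : Type} [LinearOrder V]

/-- For an active node, the list of successors is the right one iff all of them are adjacent to it
and no other unvisited node is. The sorting is already part of being a labeling. -/
theorem LabeledForest.isExplored_iff {adj : V → V → Prop} [DecidableRel adj] {E : Set (Sym2 V)}
    (hE : ∀ v w, adj v w ↔ s(v, w) ∈ E) {F : PlaneForest} {L : List V} {U : Finset V}
    {Φ : LabeledForest V} (h : Φ ∈ F.labelings L U) :
    Φ.IsExplored adj U ↔ (∀ e ∈ Φ.treeEdges, e ∈ E) ∧ ∀ e ∈ Φ.nonEdges U, e ∉ E := by
  induction F generalizing L U Φ with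
  | nil =>
    cases L <;> simp_all [PlaneForest.labelings, treeEdges, nonEdges, IsExplored]
  | cons C R ihC ihR =>
    obtain ⟨v, L', A, B, rfl, rfl, hU, hc, hs, hA, hB⟩ := PlaneForest.mem_labelings_cons h
    have h1 : A.roots = (U.filter (adj v)).sort (· ≤ ·) ↔
        (∀ w ∈ A.roots.toFinset, s(v, w) ∈ E) ∧ ∀ w ∈ U \ A.roots.toFinset, s(v, w) ∉ E := by
      have : A.roots = (U.filter (adj v)).sort (· ≤ ·) ↔
          A.roots.toFinset = U.filter (adj v) := by
        constructor
        · intro h; rw [h, Finset.sort_toFinset]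
        · intro h; rw [← h]; exact hs
      rw [this, Finset.ext_iff]
      simp only [Finset.mem_filter, hE, Finset.mem_sdiff]
      constructor
      · intro h
        exact ⟨fun w hw => ((h w).1 hw).2, fun w hw hw' => hw.2 ((h w).2 ⟨hw.1, hw'⟩)⟩
      · intro h w
        exact ⟨fun hw => ⟨hU hw, h.1 w hw⟩, fun hw => by
          by_contra hw'
          exact h.2 w ⟨hw.1, hw'⟩ hw.2⟩
    simp only [IsExplored, h1, ihC hA, ihR hB, treeEdges, nonEdges, Finset.mem_union, or_imp,
      forall_and, Finset.forall_mem_image]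
    tauto

/-- Locates every queried pair: one end becomes active during this part of the search, the other is
unvisited at its start. This separates the queries of different parts. -/
theorem LabeledForest.mem_queries {F : PlaneForest} {L : List V} {U : Finset V}
    {Φ : LabeledForest V} (h : Φ ∈ F.labelings L U) (hLU : Disjoint L.toFinset U) {e : Sym2 V}
    (he : e ∈ Φ.treeEdges ∪ Φ.nonEdges U) :
    ∃ a ∈ L.toFinset ∪ Φ.nonroots, ∃ w ∈ U, a ≠ w ∧ e = s(a, w) := by
  induction F generalizing L U Φ with
  | nil => cases L <;> simp_all [PlaneForest.labelings, treeEdges, nonEdges]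
  | cons C R ihC ihR =>
    obtain ⟨v, L', A, B, rfl, rfl, hU, hc, hs, hA, hB⟩ := PlaneForest.mem_labelings_cons h
    simp only [List.toFinset_cons, Finset.disjoint_insert_left] at hLU
    have hv : e ∈ A.roots.toFinset.image (s(v, ·)) ∪ (U \ A.roots.toFinset).image (s(v, ·)) ∨
        e ∈ A.treeEdges ∪ A.nonEdges (U \ A.roots.toFinset) ∨
        e ∈ B.treeEdges ∪ B.nonEdges (U \ (A.roots.toFinset ∪ A.nonroots)) := by
      simp only [treeEdges, nonEdges, Finset.mem_union] at he ⊢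
      tauto
    simp only [nonroots, List.toFinset_cons]
    rcases hv with hv | hv | hv
    · rw [← Finset.image_union, Finset.union_sdiff_of_subset hU, Finset.mem_image] at hv
      obtain ⟨w, hw, rfl⟩ := hv
      exact ⟨v, by simp, w, hw, fun h => hLU.1 (h ▸ hw), rfl⟩
    · obtain ⟨a, ha, w, hw, hne, rfl⟩ := ihC hA Finset.disjoint_sdiff hv
      refine ⟨a, ?_, w, Finset.sdiff_subset hw, hne, rfl⟩
      simp only [Finset.mem_union] at ha ⊢
      tauto
    · obtain ⟨a, ha, w, hw, hne, rfl⟩ := ihR hB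
        (Finset.disjoint_of_subset_right Finset.sdiff_subset hLU.2) hv
      refine ⟨a, ?_, w, Finset.sdiff_subset hw, hne, rfl⟩
      simp only [Finset.mem_union, Finset.mem_insert] at ha ⊢
      tauto

/-- No pair is queried twice. The node `v` is neither in `U` nor among the other listed nodes.
Queries below `v` have an end among the descendants of `v`, and no later query touches these, since
they have left the unvisited set. -/
theorem LabeledForest.card_queries {F : PlaneForest} {L : List V} {U : Finset V}
    {Φ : LabeledForest V} (h : Φ ∈ F.labelings L U) (hL : L.Nodup)
    (hLU : Disjoint L.toFinset U) :
    Disjoint Φ.treeEdges (Φ.nonEdges U) ∧ Φ.treeEdges.card = F.numNonroot ∧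
      Φ.treeEdges.card + (Φ.nonEdges U).card = F.queries U.card := by
  induction F generalizing L U Φ with
  | nil =>
    cases L <;> simp_all [PlaneForest.labelings, treeEdges, nonEdges, PlaneForest.numNonroot,
      PlaneForest.queries]
  | cons C R ihC ihR =>
    obtain ⟨v, L', A, B, rfl, rfl, hU, hc, hs, hA, hB⟩ := PlaneForest.mem_labelings_cons h
    simp only [List.toFinset_cons, Finset.disjoint_insert_left] at hLU
    rw [List.nodup_cons] at hL
    have hLB := Finset.disjoint_of_subset_right
      (Finset.sdiff_subset (s := U) (t := A.roots.toFinset ∪ A.nonroots)) hLU.2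
    obtain ⟨a1, a2, a3⟩ := ihC hA (by rw [hs]; exact Finset.sort_nodup _ _) Finset.disjoint_sdiff
    obtain ⟨b1, b2, b3⟩ := ihR hB hL.2 hLB
    obtain ⟨-, -, hAU, hAc⟩ := PlaneForest.mem_labelings hA
    obtain ⟨-, -, hBU, -⟩ := PlaneForest.mem_labelings hB
    have hAU' := hAU.trans Finset.sdiff_subset
    have qA := fun e => mem_queries (e := e) hA Finset.disjoint_sdiff
    have qB := fun e => mem_queries (e := e) hB hLB
    have qV : ∀ e, e ∈ A.roots.toFinset.image (s(v, ·)) ∪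
        (U \ A.roots.toFinset).image (s(v, ·)) → ∃ w ∈ U, e = s(v, w) := by
      intro e he
      rw [← Finset.image_union, Finset.union_sdiff_of_subset hU, Finset.mem_image] at he
      obtain ⟨w, hw, rfl⟩ := he
      exact ⟨w, hw, rfl⟩
    have cV : (A.roots.toFinset.image (s(v, ·))).card = C.numTrees := by
      rw [Finset.card_image_of_injective _ (fun x y h => Sym2.congr_right.1 h), hc]
    have cV' : ((U \ A.roots.toFinset).image (s(v, ·))).card = U.card - C.numTrees := by
      rw [Finset.card_image_of_injective _ (fun x y h => Sym2.congr_right.1 h),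
        Finset.card_sdiff_of_subset hU, hc]
    have dV : Disjoint (A.roots.toFinset.image (s(v, ·)))
        ((U \ A.roots.toFinset).image (s(v, ·))) := by
      rw [Finset.disjoint_image (fun x y h => Sym2.congr_right.1 h)]
      exact Finset.disjoint_sdiff
    have dVA : Disjoint (A.roots.toFinset.image (s(v, ·)) ∪
        (U \ A.roots.toFinset).image (s(v, ·)))
        (A.treeEdges ∪ A.nonEdges (U \ A.roots.toFinset)) := by
      rw [Finset.disjoint_left]
      intro e h1 h2
      obtain ⟨w, hw, rfl⟩ := qV e h1
      obtain ⟨a, ha, w', hw', -, h3⟩ := qA _ h2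
      have haU : a ∈ U := by
        rcases Finset.mem_union.1 ha with ha | ha
        · exact hU ha
        · exact hAU' ha
      have hw'U := Finset.sdiff_subset hw'
      rw [Sym2.eq_iff] at h3
      rcases h3 with ⟨rfl, -⟩ | ⟨rfl, -⟩
      · exact hLU.1 haU
      · exact hLU.1 hw'U
    have dVB : Disjoint (A.roots.toFinset.image (s(v, ·)) ∪
        (U \ A.roots.toFinset).image (s(v, ·)))
        (B.treeEdges ∪ B.nonEdges (U \ (A.roots.toFinset ∪ A.nonroots))) := by
      rw [Finset.disjoint_left]
      intro e h1 h2
      obtain ⟨w, hw, rfl⟩ := qV e h1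
      obtain ⟨a, ha, w', hw', -, h3⟩ := qB _ h2
      have hw'U := Finset.sdiff_subset hw'
      rw [Sym2.eq_iff] at h3
      rcases h3 with ⟨rfl, -⟩ | ⟨rfl, -⟩
      · rcases Finset.mem_union.1 ha with ha | ha
        · exact hL.1 (List.mem_toFinset.1 ha)
        · exact hLU.1 (Finset.sdiff_subset (hBU ha))
      · exact hLU.1 hw'U
    have dAB : Disjoint (A.treeEdges ∪ A.nonEdges (U \ A.roots.toFinset))
        (B.treeEdges ∪ B.nonEdges (U \ (A.roots.toFinset ∪ A.nonroots))) := by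
      rw [Finset.disjoint_left]
      intro e h1 h2
      obtain ⟨a, ha, w, hw, -, rfl⟩ := qA _ h1
      obtain ⟨a', ha', w', hw', -, h3⟩ := qB _ h2
      have haU : a ∈ U := by
        rcases Finset.mem_union.1 ha with ha | ha
        · exact hU ha
        · exact hAU' ha
      have h4 : a ≠ w' := fun h => (Finset.mem_sdiff.1 hw').2 (h ▸ ha)
      have h5 : a ≠ a' := by
        rintro rfl
        rcases Finset.mem_union.1 ha' with ha' | ha'
        · exact (Finset.disjoint_left.1 hLU.2 ha') haU
        · exact (Finset.mem_sdiff.1 (hBU ha')).2 ha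
      rw [Sym2.eq_iff] at h3
      tauto
    simp only [Finset.disjoint_union_left, Finset.disjoint_union_right] at dVA dVB dAB
    obtain ⟨⟨x1, x2⟩, x3, x4⟩ := dVA
    obtain ⟨⟨y1, y2⟩, y3, y4⟩ := dVB
    obtain ⟨⟨z1, z2⟩, z3, z4⟩ := dAB
    have hCU : C.numTrees ≤ U.card := hc ▸ Finset.card_le_card hU
    have hcard : (A.roots.toFinset ∪ A.nonroots).card = C.numNodes := by
      rw [Finset.card_union_of_disjoint
        (Finset.disjoint_of_subset_left hAU Finset.sdiff_disjoint).symm, hc, hAc,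
        PlaneForest.numNodes_eq]
    rw [Finset.card_sdiff_of_subset hU, hc] at a3
    rw [Finset.card_sdiff_of_subset (Finset.union_subset hU hAU'), hcard] at b3
    have cT : (cons v A B).treeEdges.card = C.numTrees + A.treeEdges.card + B.treeEdges.card := by
      simp only [treeEdges]
      rw [Finset.card_union_of_disjoint, Finset.card_union_of_disjoint x1, cV]
      exact Finset.disjoint_union_left.2 ⟨y1, z1⟩
    have cN : ((cons v A B).nonEdges U).card = U.card - C.numTrees +
        (A.nonEdges (U \ A.roots.toFinset)).card +
        (B.nonEdges (U \ (A.roots.toFinset ∪ A.nonroots))).card := by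
      simp only [nonEdges]
      rw [Finset.card_union_of_disjoint, Finset.card_union_of_disjoint x4, cV']
      exact Finset.disjoint_union_left.2 ⟨y4, z4⟩
    refine ⟨?_, ?_, ?_⟩
    · simp only [treeEdges, nonEdges]
      refine Finset.disjoint_union_left.2 ⟨Finset.disjoint_union_left.2
        ⟨Finset.disjoint_union_right.2 ⟨Finset.disjoint_union_right.2 ⟨dV, ?_⟩, ?_⟩,
          Finset.disjoint_union_right.2 ⟨Finset.disjoint_union_right.2 ⟨?_, a1⟩, ?_⟩⟩,
        Finset.disjoint_union_right.2 ⟨Finset.disjoint_union_right.2 ⟨?_, ?_⟩, b1⟩⟩ <;>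
      first | assumption | (apply Disjoint.symm; assumption)
    · rw [cT, a2, b2, PlaneForest.numNonroot, PlaneForest.numNodes_eq]
    · rw [cT, cN, PlaneForest.queries, ← a3, ← b3]
      omega

theorem PlaneForest.mem_rootedLabelings_cons {C R : PlaneForest} {U : Finset V}
    {Φ : LabeledForest V} (h : Φ ∈ (PlaneForest.cons C R).rootedLabelings U) :
    ∃ hU : U.Nonempty, ∃ A B, Φ = .cons (U.max' hU) A B ∧
      .cons (U.max' hU) A .nil ∈ (PlaneForest.cons C .nil).labelings [U.max' hU]
        (U.erase (U.max' hU)) ∧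
      B ∈ R.rootedLabelings (U.erase (U.max' hU) \
        (LabeledForest.cons (U.max' hU) A .nil).nonroots) := by
  by_cases hU : U.Nonempty
  · simp only [rootedLabelings, dif_pos hU, Finset.mem_biUnion, Finset.mem_image] at h
    obtain ⟨Φ, hΦ, B, hB, rfl⟩ := h
    obtain ⟨v, L, A, B', hL, rfl, -⟩ := mem_labelings_cons hΦ
    have r1 := (mem_labelings hΦ).1
    cases B' with
    | cons => simp [LabeledForest.roots] at r1
    | nil =>
      simp only [LabeledForest.roots, List.cons.injEq, and_true] at r1
      subst r1
      exact ⟨hU, A, B, rfl, hΦ, hB⟩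
  · simp [rootedLabelings, hU] at h

theorem LabeledForest.erase_of_mem_rootedLabelings {F : PlaneForest} {U : Finset V}
    {Φ : LabeledForest V} (h : Φ ∈ F.rootedLabelings U) : Φ.erase = F := by
  induction F generalizing U Φ with
  | nil =>
    by_cases hU : U = ∅ <;> simp_all [PlaneForest.rootedLabelings, erase]
  | cons C R _ ihR =>
    obtain ⟨hU, A, B, rfl, hA, hB⟩ := PlaneForest.mem_rootedLabelings_cons h
    have h1 := (PlaneForest.mem_labelings hA).2.1
    simp only [erase, PlaneForest.cons.injEq, and_true] at h1 ⊢
    exact ⟨h1, ihR hB⟩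

theorem LabeledForest.treeEdges_cons (v : V) (A B : LabeledForest V) :
    (cons v A B).treeEdges = (cons v A nil).treeEdges ∪ B.treeEdges := by
  simp [treeEdges]

theorem LabeledForest.isSearched_iff {adj : V → V → Prop} [DecidableRel adj] {E : Set (Sym2 V)}
    (hE : ∀ v w, adj v w ↔ s(v, w) ∈ E) {F : PlaneForest} {U : Finset V}
    {Φ : LabeledForest V} (h : Φ ∈ F.rootedLabelings U) :
    Φ.IsSearched adj U ↔ (∀ e ∈ Φ.treeEdges, e ∈ E) ∧ ∀ e ∈ Φ.searchNonEdges U, e ∉ E := by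
  induction F generalizing U Φ with
  | nil =>
    by_cases hU : U = ∅ <;>
      simp_all [PlaneForest.rootedLabelings, IsSearched, treeEdges, searchNonEdges]
  | cons C R _ ihR =>
    obtain ⟨hU, A, B, rfl, hA, hB⟩ := PlaneForest.mem_rootedLabelings_cons h
    simp only [IsSearched, hU, exists_true_left, true_and, isExplored_iff hE hA, ihR hB,
      treeEdges_cons _ A B, searchNonEdges, Finset.mem_union, or_imp, forall_and]
    tauto

theorem LabeledForest.mem_searchQueries {F : PlaneForest} {U : Finset V}
    {Φ : LabeledForest V} (h : Φ ∈ F.rootedLabelings U) {e : Sym2 V}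
    (he : e ∈ Φ.treeEdges ∪ Φ.searchNonEdges U) :
    ∃ a ∈ U, ∃ w ∈ U, a ≠ w ∧ e = s(a, w) := by
  induction F generalizing U Φ with
  | nil =>
    by_cases hU : U = ∅ <;> simp_all [PlaneForest.rootedLabelings, treeEdges, searchNonEdges]
  | cons C R _ ihR =>
    obtain ⟨hU, A, B, rfl, hA, hB⟩ := PlaneForest.mem_rootedLabelings_cons h
    have hm := U.max'_mem hU
    set v := U.max' hU
    rw [treeEdges_cons, searchNonEdges] at he
    have hv : e ∈ (cons v A nil).treeEdges ∪ (cons v A nil).nonEdges (U.erase v) ∨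
        e ∈ B.treeEdges ∪ B.searchNonEdges (U.erase v \ (cons v A nil).nonroots) := by
      simp only [Finset.mem_union] at he ⊢
      tauto
    rcases hv with hv | hv
    · obtain ⟨a, ha, w, hw, hne, rfl⟩ := mem_queries hA (by simp) hv
      refine ⟨a, ?_, w, Finset.erase_subset _ _ hw, hne, rfl⟩
      rcases Finset.mem_union.1 ha with ha | ha
      · simp only [List.toFinset_cons, List.toFinset_nil, insert_empty_eq,
          Finset.mem_singleton] at ha
        rwa [ha]
      · exact Finset.erase_subset _ _ ((PlaneForest.mem_labelings hA).2.2.1 ha)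
    · obtain ⟨a, ha, w, hw, hne, rfl⟩ := ihR hB hv
      have hs := Finset.sdiff_subset (s := U.erase v) (t := (cons v A nil).nonroots)
      exact ⟨a, Finset.erase_subset _ _ (hs ha), w, Finset.erase_subset _ _ (hs hw), hne, rfl⟩

theorem LabeledForest.card_searchQueries {F : PlaneForest} {U : Finset V}
    {Φ : LabeledForest V} (h : Φ ∈ F.rootedLabelings U) (hU : U.card = F.numNodes) :
    Disjoint Φ.treeEdges (Φ.searchNonEdges U) ∧ Φ.treeEdges.card = F.numNonroot ∧
      Φ.treeEdges.card + (Φ.searchNonEdges U).card = F.forestQueries := by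
  induction F generalizing U Φ with
  | nil =>
    have hU : U = ∅ := by simpa [PlaneForest.numNodes] using hU
    simp_all [PlaneForest.rootedLabelings, treeEdges, searchNonEdges, PlaneForest.numNonroot,
      PlaneForest.forestQueries]
  | cons C R _ ihR =>
    obtain ⟨hne, A, B, rfl, hA, hB⟩ := PlaneForest.mem_rootedLabelings_cons h
    have hm := U.max'_mem hne
    set v := U.max' hne
    have hE := Finset.card_erase_of_mem hm
    obtain ⟨-, -, h3, h4⟩ := PlaneForest.mem_labelings hA
    have hc : U.card - 1 = C.numNodes + R.numNodes := by
      rw [hU]; simp only [PlaneForest.numNodes]; omega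
    obtain ⟨a1, a2, a3⟩ := card_queries hA (by simp) (by simp)
    obtain ⟨b1, b2, b3⟩ := ihR hB (by
      rw [Finset.card_sdiff_of_subset h3, h4, hE, hc]
      simp [PlaneForest.numNonroot])
    rw [hE, hc] at a3
    have hd : Disjoint ((cons v A nil).treeEdges ∪ (cons v A nil).nonEdges (U.erase v))
        (B.treeEdges ∪ B.searchNonEdges (U.erase v \ (cons v A nil).nonroots)) := by
      rw [Finset.disjoint_left]
      intro e h1 h2
      obtain ⟨a, ha, w, hw, -, rfl⟩ := mem_queries hA (by simp) h1
      obtain ⟨a', ha', w', hw', -, h5⟩ := mem_searchQueries hB h2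
      have ha'' : ∀ x ∈ U.erase v \ (cons v A nil).nonroots, a ≠ x := by
        rintro x hx rfl
        rw [Finset.mem_sdiff, Finset.mem_erase] at hx
        rcases Finset.mem_union.1 ha with ha | ha
        · simp only [List.toFinset_cons, List.toFinset_nil, insert_empty_eq,
            Finset.mem_singleton] at ha
          exact hx.1.1 ha
        · exact hx.2 ha
      rw [Sym2.eq_iff] at h5
      have := ha'' _ ha'
      have := ha'' _ hw'
      tauto
    simp only [Finset.disjoint_union_left, Finset.disjoint_union_right] at hd
    obtain ⟨⟨x1, x2⟩, x3, x4⟩ := hd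
    have cT : (cons v A B).treeEdges.card = (cons v A nil).treeEdges.card + B.treeEdges.card := by
      rw [treeEdges_cons, Finset.card_union_of_disjoint x1]
    have cN : ((cons v A B).searchNonEdges U).card = ((cons v A nil).nonEdges (U.erase v)).card +
        (B.searchNonEdges (U.erase v \ (cons v A nil).nonroots)).card := by
      rw [searchNonEdges, Finset.card_union_of_disjoint x4]
    refine ⟨?_, ?_, ?_⟩
    · rw [treeEdges_cons, searchNonEdges]
      refine Finset.disjoint_union_left.2 ⟨Finset.disjoint_union_right.2 ⟨a1, ?_⟩,
        Finset.disjoint_union_right.2 ⟨?_, b1⟩⟩ <;>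
      first | assumption | (apply Disjoint.symm; assumption)
    · rw [cT, a2, b2]
      simp [PlaneForest.numNonroot]
    · rw [cT, cN, PlaneForest.forestQueries, ← a3, ← b3]
      omega

end Queries

/-! ### Edge generating functions -/

open Classical in
theorem sum_pow_card_of_subset_of_disjoint {α : Type*} [DecidableEq α] {A T S : Finset α} (t : ℝ)
    (hT : T ⊆ A) (hS : S ⊆ A) (hd : Disjoint T S) (P : Finset α → Prop)
    (hP : ∀ E, P E ↔ (∀ e ∈ T, e ∈ E) ∧ ∀ e ∈ S, e ∉ E) :
    ∑ E ∈ A.powerset with P E, t ^ E.card =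
      t ^ T.card * (1 + t) ^ (A.card - (T.card + S.card)) := by
  have h1 : ∑ E ∈ (A \ (T ∪ S)).powerset, t ^ (T ∪ E).card =
      ∑ E ∈ A.powerset with P E, t ^ E.card := by
    simp only [hP]
    -- An admissible set is `T` together with an arbitrary set of pairs avoiding `T ∪ S`.
    refine Finset.sum_bij' (fun E _ => T ∪ E) (fun E _ => E \ T) ?_ ?_ ?_ ?_ ?_
    · intro E hE
      simp only [Finset.mem_powerset, Finset.mem_filter] at hE ⊢
      refine ⟨Finset.union_subset hT (hE.trans Finset.sdiff_subset), fun e he =>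
        Finset.mem_union_left _ he, fun e he he' => ?_⟩
      rcases Finset.mem_union.1 he' with h | h
      · exact Finset.disjoint_left.1 hd h he
      · exact (Finset.mem_sdiff.1 (hE h)).2 (Finset.mem_union_right _ he)
    · intro E hE
      simp only [Finset.mem_powerset, Finset.mem_filter] at hE ⊢
      intro e he
      rw [Finset.mem_sdiff] at he
      simp only [Finset.mem_sdiff, Finset.mem_union, not_or]
      exact ⟨hE.1 he.1, he.2, fun h => hE.2.2 e h he.1⟩
    · intro E hE
      rw [Finset.mem_powerset] at hE
      ext e
      have : e ∈ E → e ∉ T := fun h h' =>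
        (Finset.mem_sdiff.1 (hE h)).2 (Finset.mem_union_left _ h')
      simp only [Finset.mem_sdiff, Finset.mem_union]
      tauto
    · intro E hE
      exact Finset.union_sdiff_of_subset (Finset.mem_filter.1 hE).2.1
    · intro E hE
      rfl
  have h2 : ∀ E ∈ (A \ (T ∪ S)).powerset, t ^ (T ∪ E).card =
      t ^ T.card * (t ^ E.card * 1 ^ ((A \ (T ∪ S)).card - E.card)) := by
    intro E hE
    rw [Finset.card_union_of_disjoint, pow_add, one_pow, mul_one]
    rw [Finset.disjoint_right]
    intro e he he'
    exact (Finset.mem_sdiff.1 (Finset.mem_powerset.1 hE he)).2 (Finset.mem_union_left _ he')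
  rw [← h1, Finset.sum_congr rfl h2, ← Finset.mul_sum, Finset.sum_pow_mul_eq_add_pow,
    Finset.card_sdiff_of_subset (Finset.union_subset hT hS), Finset.card_union_of_disjoint hd,
    add_comm t]

open Classical in
theorem edgeGenFun_eq_sum_powerset {N : ℕ} (t : ℝ) (p : SimpleGraph (Fin N) → Prop)
    (P : Finset (Sym2 (Fin N)) → Prop) (h : ∀ G : SimpleGraph (Fin N), p G ↔ P G.edgeFinset) :
    edgeGenFun t p = ∑ E ∈ (⊤ : SimpleGraph (Fin N)).edgeFinset.powerset with P E,
      t ^ E.card := by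
  -- Quantified over the `Fintype` instance, so that it rewrites `edgeFinset` whichever instance
  -- occurs.
  have key : ∀ E ∈ (⊤ : SimpleGraph (Fin N)).edgeFinset.powerset,
      ∀ _ : Fintype (SimpleGraph.fromEdgeSet (E : Set (Sym2 (Fin N)))).edgeSet,
      (SimpleGraph.fromEdgeSet (E : Set (Sym2 (Fin N)))).edgeFinset = E := by
    intro E hE _
    rw [Finset.mem_powerset] at hE
    ext e
    simp only [SimpleGraph.mem_edgeFinset, SimpleGraph.edgeSet_fromEdgeSet, Set.mem_sdiff,
      Finset.mem_coe]
    refine ⟨fun h => h.1, fun h => ⟨h, ?_⟩⟩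
    have := hE h
    rw [SimpleGraph.mem_edgeFinset] at this
    exact SimpleGraph.not_isDiag_of_mem_edgeSet _ this
  unfold edgeGenFun
  refine Finset.sum_bij' (fun G _ => G.edgeFinset)
    (fun E _ => SimpleGraph.fromEdgeSet (E : Set (Sym2 (Fin N)))) ?_ ?_ ?_ ?_ ?_
  · intro G hG
    rw [Finset.mem_filter] at hG ⊢
    exact ⟨Finset.mem_powerset.2 (SimpleGraph.edgeFinset_mono le_top), (h G).1 hG.2⟩
  · intro E hE
    rw [Finset.mem_filter] at hE ⊢
    refine ⟨Finset.mem_univ _, (h _).2 ?_⟩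
    rw [key E hE.1]; exact hE.2
  · intro G _
    simp
  · intro E hE
    exact key E (Finset.mem_filter.1 hE).1 _
  · intro G _
    rw [← SimpleGraph.coe_edgeFinset, Set.ncard_coe_finset]

theorem card_edgeFinset_top_fin (N : ℕ) [Fintype (⊤ : SimpleGraph (Fin N)).edgeSet] :
    (⊤ : SimpleGraph (Fin N)).edgeFinset.card = N.choose 2 := by
  have := SimpleGraph.card_edgeFinset_top_eq_card_choose_two (V := Fin N)
  rw [Fintype.card_fin] at this
  convert this

/-- The pairs in `T` are present, those in `S` absent, and each remaining pair is chosen freely with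
weight `1` or `t`. -/
theorem edgeGenFun_eq_of_cylinder {N : ℕ} (t : ℝ) (p : SimpleGraph (Fin N) → Prop)
    {T S : Finset (Sym2 (Fin N))} (hTS : ∀ e ∈ T ∪ S, ¬ e.IsDiag) (hd : Disjoint T S)
    (hp : ∀ G : SimpleGraph (Fin N), p G ↔
      (∀ e ∈ T, e ∈ G.edgeSet) ∧ ∀ e ∈ S, e ∉ G.edgeSet) :
    edgeGenFun t p = t ^ T.card * (1 + t) ^ (N.choose 2 - (T.card + S.card)) := by
  have hsub : T ∪ S ⊆ (⊤ : SimpleGraph (Fin N)).edgeFinset := by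
    intro e he
    have := hTS e he
    simpa using this
  rw [edgeGenFun_eq_sum_powerset t p (fun E => (∀ e ∈ T, e ∈ E) ∧ ∀ e ∈ S, e ∉ E)
    (fun G => by simp [hp])]
  refine (sum_pow_card_of_subset_of_disjoint t (Finset.subset_union_left.trans hsub)
    (Finset.subset_union_right.trans hsub) hd _ (fun _ => Iff.rfl)).trans ?_
  rw [card_edgeFinset_top_fin]

theorem edgeGenFun_true (N : ℕ) (t : ℝ) :
    edgeGenFun t (fun _ : SimpleGraph (Fin N) => True) = (1 + t) ^ N.choose 2 := by
  rw [edgeGenFun_eq_of_cylinder (T := ∅) (S := ∅) t _ (by simp) (by simp) (by simp)]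
  simp

/-- The fiber of `Ψ` over `F` splits into the fibers of `Φ` over the labelings of `F`. Each is a
cylinder whose numbers of fixed edges and of free pairs depend on `F` only. -/
theorem edgeGenFun_graphPsi_eq {N : ℕ} (t : ℝ) (F : PlaneForest) (hF : F.numNodes = N) :
    edgeGenFun t (fun G : SimpleGraph (Fin N) => graphPsi G = F) =
      (F.rootedLabelings (Finset.univ : Finset (Fin N))).card *
        (t ^ F.numNonroot * (1 + t) ^ F.forestExp) := by
  classical
  have h1 : ∀ Φ ∈ F.rootedLabelings (Finset.univ : Finset (Fin N)),
      edgeGenFun t (fun G : SimpleGraph (Fin N) => graphPhi G = Φ) =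
        t ^ F.numNonroot * (1 + t) ^ F.forestExp := by
    intro Φ hΦ
    have hcard : (Finset.univ : Finset (Fin N)).card = F.numNodes := by simp [hF]
    obtain ⟨d, cT, cQ⟩ := LabeledForest.card_searchQueries hΦ hcard
    rw [edgeGenFun_eq_of_cylinder t _ ?_ d ?_, cQ, cT, ← hF, ← F.forestQueries_add_forestExp,
      Nat.add_sub_cancel_left]
    · intro e he
      obtain ⟨a, -, w, -, hne, rfl⟩ := LabeledForest.mem_searchQueries hΦ he
      simpa using hne
    · intro G
      rw [graphPhi, nfsForest_eq_iff, LabeledForest.isSearched_iff (adj := G.Adj) (E := G.edgeSet)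
        (fun v w => Iff.rfl) hΦ]
  have h2 : edgeGenFun t (fun G : SimpleGraph (Fin N) => graphPsi G = F) =
      ∑ Φ ∈ F.rootedLabelings (Finset.univ : Finset (Fin N)),
        edgeGenFun t (fun G : SimpleGraph (Fin N) => graphPhi G = Φ) := by
    unfold edgeGenFun
    rw [← Finset.sum_fiberwise_of_maps_to (g := graphPhi)
      (t := F.rootedLabelings (Finset.univ : Finset (Fin N)))]
    · refine Finset.sum_congr rfl fun Φ hΦ => Finset.sum_congr ?_ fun _ _ => rfl
      ext G
      simp only [Finset.mem_filter, Finset.mem_univ, true_and, and_iff_right_iff_imp]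
      rintro rfl
      exact LabeledForest.erase_of_mem_rootedLabelings hΦ
    · intro G hG
      rw [Finset.mem_filter] at hG
      rw [← hG.2]
      exact ((nfsForest_eq_iff G.Adj _).1 rfl).mem_rootedLabelings
  rw [h2, Finset.sum_congr rfl h1, Finset.sum_const, nsmul_eq_mul]

theorem numNodes_graphPsi {N : ℕ} (G : SimpleGraph (Fin N)) : (graphPsi G).numNodes = N := by
  classical
  have := ((nfsForest_eq_iff G.Adj _).1 rfl).numNodes_erase
  rwa [Finset.card_univ, Fintype.card_fin] at this

theorem edgeGenFun_graphPsi {n : ℕ} (t : ℝ) (F : PlaneForest) (hF : F.numNodes = n + 1) :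
    edgeGenFun t (fun G : SimpleGraph (Fin (n + 1)) => graphPsi G = F) =
      (n ! : ℝ) / F.degFact / F.tailProd * t ^ F.numNonroot * (1 + t) ^ F.forestExp := by
  rw [edgeGenFun_graphPsi_eq t F hF, ← mul_assoc]
  congr 2
  cases F with
  | nil => simp [PlaneForest.numNodes] at hF
  | cons C R =>
    have h := PlaneForest.card_rootedLabelings C R (Finset.univ : Finset (Fin (n + 1)))
      (by simp [hF])
    have hn : C.numNodes + R.numNodes = n := by
      simp only [PlaneForest.numNodes] at hF; omega
    rw [hn] at h
    have h1 := (PlaneForest.cons C R).degFact_pos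
    have h2 := (PlaneForest.cons C R).tailProd_pos
    rw [← h]
    push_cast
    field_simp

/-! ### Chains of inequalities among siblings and their volumes -/

/-- The chain of inequalities `1 ≤ c₁ ≤ … ≤ cₖ ≤ b` for the coordinates of siblings. -/
def sibChain (q : ℝ) (y : ℕ → ℝ) (b : ℝ) (L : List (ℕ × ℕ)) : Prop :=
  ((1 :: L.map fun c => y c.1 / q ^ c.2) ++ [b]).IsChain (· ≤ ·)

theorem PlaneForest.siblings_succ (p j k : ℕ) :
    siblings p j (k + 1) = siblings (p + 1) (j + 1) k ++ [(p, j)] := by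
  simp only [siblings, List.range_succ_eq_map, List.reverse_cons, List.map_append,
    ← List.map_reverse, List.map_map, List.map_cons, List.map_nil, add_zero]
  congr 1
  refine List.map_congr_left fun i _ => ?_
  simp only [Function.comp, Nat.succ_eq_add_one, Prod.mk.injEq]
  omega

open PlaneForest

theorem sibChain_zero (q : ℝ) (y : ℕ → ℝ) (b : ℝ) (p j : ℕ) :
    sibChain q y b (siblings p j 0) ↔ 1 ≤ b := by
  simp [sibChain, siblings]

/-- The rightmost sibling, which is visited first, becomes the upper bound for the others. This is
why chains are considered with an arbitrary upper bound `b`. -/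
theorem sibChain_succ (q : ℝ) (y : ℕ → ℝ) (b : ℝ) (p j k : ℕ) :
    sibChain q y b (siblings p j (k + 1)) ↔
      sibChain q y (y p / q ^ j) (siblings (p + 1) (j + 1) k) ∧ y p / q ^ j ≤ b := by
  simp only [sibChain, siblings_succ, List.map_append, List.map_cons, List.map_nil]
  rw [← List.cons_append, List.isChain_append, List.getLast?_concat]
  simp

theorem sibChain_one_le {q : ℝ} {y : ℕ → ℝ} {b : ℝ} {p j k : ℕ}
    (h : sibChain q y b (siblings p j k)) : 1 ≤ b := by
  induction k generalizing p j b with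
  | zero => exact (sibChain_zero _ _ _ _ _).1 h
  | succ k ih =>
    rw [sibChain_succ] at h
    exact (ih h.1).trans h.2

theorem sibChain_congr (q : ℝ) {y y' : ℕ → ℝ} (b : ℝ) {p p' : ℕ} (j k : ℕ)
    (h : ∀ i < k, y (p + i) = y' (p' + i)) :
    sibChain q y b (siblings p j k) ↔ sibChain q y' b (siblings p' j k) := by
  induction k generalizing p p' j b with
  | zero => simp only [sibChain_zero]
  | succ k ih =>
    have h0 : y p = y' p' := by simpa using h 0 (by omega)
    rw [sibChain_succ, sibChain_succ, h0, ih (p' := p' + 1)]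
    intro i hi
    have := h (i + 1) (by omega)
    rwa [show p + 1 + i = p + (i + 1) by ring, show p' + 1 + i = p' + (i + 1) by ring]

theorem measurableSet_sibChain {X : Type*} [MeasurableSpace X] (q : ℝ) {y : ℕ → X → ℝ}
    (hy : ∀ i, Measurable (y i)) {b : X → ℝ} (hb : Measurable b) (p j k : ℕ) :
    MeasurableSet {x | sibChain q (fun i => y i x) (b x) (siblings p j k)} := by
  induction k generalizing p j b with
  | zero =>
    simp only [sibChain_zero]
    exact measurableSet_le measurable_const hb
  | succ k ih =>
    simp only [sibChain_succ]
    exact (ih ((hy p).div_const _) _ _).inter (measurableSet_le ((hy p).div_const _) hb)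

theorem measurable_entry {n : ℕ} (i : ℕ) : Measurable fun x : Fin n → ℝ => entry x i := by
  unfold entry
  by_cases h : i < n
  · simp only [h, dif_pos]; exact measurable_pi_apply _
  · simp only [h, dif_neg, not_false_iff]; exact measurable_const

theorem entry_succ {n : ℕ} (x : Fin (n + 1) → ℝ) (i : ℕ) :
    entry x (i + 1) = entry (Fin.tail x) i := by
  unfold entry
  by_cases h : i < n
  · simp [h, Fin.tail]
  · simp [h]

theorem entry_zero {n : ℕ} (x : Fin (n + 1) → ℝ) : entry x 0 = x 0 := by simp [entry]

theorem entry_val {n : ℕ} (x : Fin n → ℝ) (i : Fin n) : entry x i = x i := by simp [entry]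

/-- Integrate over the coordinate `a` of the rightmost sibling: the slice is a chain of `k` siblings
with bound `a / q ^ j` and exponent `j + 1`. The result is the volume of an ordered simplex of side
`b - 1`, scaled by `q ^ j, …, q ^ (j + k - 1)`. -/
theorem volume_sibChain {q : ℝ} (hq : 0 < q) (k j : ℕ) {b : ℝ} (hb : 1 ≤ b) :
    volume {x : Fin k → ℝ | sibChain q (entry x) b (siblings 0 j k)} =
      ENNReal.ofReal ((b - 1) ^ k / k ! * q ^ (k * j + k.choose 2)) := by
  induction k generalizing j b with
  | zero => simp [sibChain_zero, hb, volume_pi]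
  | succ k ih =>
    set S : Set (ℝ × (Fin k → ℝ)) := {p | sibChain q (entry p.2) (p.1 / q ^ j)
      (siblings 0 (j + 1) k) ∧ p.1 / q ^ j ≤ b} with hS
    have hSm : MeasurableSet S :=
      (measurableSet_sibChain q (fun i => (measurable_entry i).comp measurable_snd)
        (measurable_fst.div_const _) _ _ _).inter
        (measurableSet_le (measurable_fst.div_const _) measurable_const)
    have hpre : {x : Fin (k + 1) → ℝ | sibChain q (entry x) b (siblings 0 j (k + 1))} =
        (MeasurableEquiv.piFinSuccAbove (fun _ => ℝ) 0) ⁻¹' S := by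
      ext x
      simp only [Set.mem_ofPred_eq, sibChain_succ, Set.mem_preimage, hS, entry_zero,
        MeasurableEquiv.piFinSuccAbove_apply]
      rw [sibChain_congr q (y' := entry (Fin.tail x)) (p' := 0)]
      · rfl
      · intro i _
        simp only [zero_add]
        rw [Nat.add_comm 1 i]
        exact entry_succ x i
    have hqj : 0 < q ^ j := by positivity
    -- Outside this interval the slice is empty: the chain forces `1 ≤ a / q ^ j ≤ b`.
    have hslice : ∀ a : ℝ, volume (Prod.mk a ⁻¹' S) = (Set.Icc (q ^ j) (q ^ j * b)).indicator
        (fun a => ENNReal.ofReal ((a / q ^ j - 1) ^ k / k ! *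
          q ^ (k * (j + 1) + k.choose 2))) a := by
      intro a
      by_cases ha : a ∈ Set.Icc (q ^ j) (q ^ j * b)
      · rw [Set.indicator_of_mem ha, ← ih (j + 1) ((one_le_div hqj).2 ha.1)]
        congr 1
        ext z
        simp only [hS, Set.mem_preimage, Set.mem_ofPred_eq, and_iff_left_iff_imp]
        intro _
        rw [div_le_iff₀' hqj]
        exact ha.2
      · rw [Set.indicator_of_notMem ha]
        convert measure_empty (μ := (volume : Measure (Fin k → ℝ)))
        rw [Set.eq_empty_iff_forall_notMem]
        rintro z ⟨h1, h2⟩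
        exact ha ⟨(one_le_div hqj).1 (sibChain_one_le h1), (div_le_iff₀' hqj).1 h2⟩
    rw [hpre, (volume_preserving_piFinSuccAbove (fun _ : Fin (k + 1) => ℝ) 0).measure_preimage_equiv,
      Measure.volume_eq_prod, Measure.prod_apply hSm]
    simp only [hslice]
    have hle : q ^ j ≤ q ^ j * b := le_mul_of_one_le_right hqj.le hb
    rw [lintegral_indicator measurableSet_Icc, ← ofReal_integral_eq_lintegral_ofReal]
    · congr 1
      rw [integral_Icc_eq_integral_Ioc, ← intervalIntegral.integral_of_le hle,
        intervalIntegral.integral_comp_div_sub (fun x => x ^ k / k ! *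
          q ^ (k * (j + 1) + k.choose 2)) hqj.ne', intervalIntegral.integral_mul_const,
        intervalIntegral.integral_div, integral_pow, div_self hqj.ne', sub_self,
        mul_div_cancel_left₀ _ hqj.ne', Nat.factorial_succ, Nat.choose_succ_succ' k 1,
        Nat.choose_one_right]
      have hk : (k ! : ℝ) ≠ 0 := by positivity
      push_cast
      rw [smul_eq_mul, zero_pow (Nat.succ_ne_zero k), sub_zero,
        show (k + 1) * j + (k + k.choose 2) = j + (k * (j + 1) + k.choose 2) by ring,
        pow_add q j]
      field_simp
    · refine Continuous.integrableOn_Icc ?_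
      fun_prop
    · refine (ae_restrict_iff' measurableSet_Icc).2 (Filter.Eventually.of_forall fun a ha => ?_)
      have : 1 ≤ a / q ^ j := (one_le_div hqj).2 ha.1
      have : 0 ≤ a / q ^ j - 1 := by linarith
      simp only [Pi.zero_apply]
      positivity

/-! ### Products and cones -/

theorem volume_prodSet {a b : ℕ} (P : Set (Fin a → ℝ)) (Q : Set (Fin b → ℝ)) :
    volume (prodSet P Q) = volume P * volume Q := by
  have h1 := volume_measurePreserving_sumPiEquivProdPi (fun _ : Fin a ⊕ Fin b => ℝ)
  have h2 := (volume_measurePreserving_piCongrLeft (fun _ : Fin (a + b) => ℝ)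
    finSumFinEquiv).symm
  rw [← Measure.prod_prod, ← Measure.volume_eq_prod,
    ← h1.measure_preimage_equiv, ← h2.measure_preimage_equiv]
  rfl

theorem measurableSet_prodSet {a b : ℕ} {P : Set (Fin a → ℝ)} {Q : Set (Fin b → ℝ)}
    (hP : MeasurableSet P) (hQ : MeasurableSet Q) : MeasurableSet (prodSet P Q) :=
  (hP.preimage (by fun_prop : Measurable fun (x : Fin (a + b) → ℝ) i => x (Fin.castAdd b i))).inter
    (hQ.preimage (by fun_prop : Measurable fun (x : Fin (a + b) → ℝ) i => x (Fin.natAdd a i)))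

open scoped Pointwise in
-- At height `a > 0` the slice is `a • P`, of volume `a ^ n * volume P`, and `∫ a ^ n = 1 / (n + 1)`
-- over the unit interval. The apex, where one cannot divide by the height, is kept apart in the
-- null set `Z`.
theorem volume_coneSet {n : ℕ} {P : Set (Fin n → ℝ)} (hP : MeasurableSet P) :
    volume (coneSet P) = volume P / (n + 1 : ℕ) ∧ MeasurableSet (coneSet P) := by
  set S : Set (ℝ × (Fin n → ℝ)) := {p | (0 < p.1 ∧ p.1 ≤ 1) ∧ p.1⁻¹ • p.2 ∈ P} with hS
  set Z : Set (ℝ × (Fin n → ℝ)) := {p | p = 0 ∧ P.Nonempty} with hZ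
  have hSm : MeasurableSet S :=
    ((measurableSet_lt measurable_const measurable_fst).inter
      (measurableSet_le measurable_fst measurable_const)).inter
      (hP.preimage (measurable_fst.inv.smul measurable_snd))
  have hZm : MeasurableSet Z := by
    by_cases h : P.Nonempty
    · simp only [hZ, h, and_true]; exact measurableSet_singleton _
    · simp [hZ, h]
  have hpre : coneSet P = (MeasurableEquiv.piFinSuccAbove (fun _ => ℝ) 0) ⁻¹' (S ∪ Z) := by
    ext x
    have h2 : ((MeasurableEquiv.piFinSuccAbove (fun _ => ℝ) 0) x).2 = Fin.tail x := rfl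
    have h1 : ((MeasurableEquiv.piFinSuccAbove (fun _ => ℝ) 0) x).1 = x 0 := rfl
    simp only [coneSet, hS, hZ, Set.mem_preimage, Set.mem_union, Set.mem_ofPred_eq, h1, h2,
      Prod.ext_iff, Prod.fst_zero, Prod.snd_zero]
    constructor
    · rintro ⟨h0, hle, y, hy, hxy⟩
      rcases h0.eq_or_lt with h0 | h0
      · right
        rw [← h0, zero_smul] at hxy
        exact ⟨⟨h0.symm, hxy⟩, y, hy⟩
      · left
        rw [hxy, inv_smul_smul₀ h0.ne']
        exact ⟨⟨h0, hle⟩, hy⟩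
    · rintro (⟨⟨h0, hle⟩, hy⟩ | ⟨⟨h0, hx⟩, y, hy⟩)
      · exact ⟨h0.le, hle, _, hy, by rw [smul_inv_smul₀ h0.ne']⟩
      · exact ⟨h0.ge, by rw [h0]; exact zero_le_one, y, hy, by rw [h0, hx, zero_smul]⟩
  refine ⟨?_, hpre ▸ (MeasurableEquiv.measurable _ (hSm.union hZm))⟩
  have hZ0 : (volume : Measure (ℝ × (Fin n → ℝ))) Z = 0 := by
    refine measure_mono_null (t := ({0} : Set ℝ) ×ˢ Set.univ) ?_ ?_
    · rintro p ⟨rfl, -⟩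
      simp
    · rw [Measure.volume_eq_prod, Measure.prod_prod]
      simp
  have hslice : ∀ a : ℝ, volume (Prod.mk a ⁻¹' S) = (Set.Ioc (0 : ℝ) 1).indicator
      (fun a => ENNReal.ofReal (a ^ n) * volume P) a := by
    intro a
    by_cases ha : a ∈ Set.Ioc (0 : ℝ) 1
    · rw [Set.indicator_of_mem ha]
      have : Prod.mk a ⁻¹' S = a • P := by
        rw [← Set.preimage_smul_inv₀ ha.1.ne']
        ext z
        simp only [hS, Set.mem_preimage, Set.mem_ofPred_eq]
        exact and_iff_right ha
      rw [this, Measure.addHaar_smul, Module.finrank_fin_fun, abs_of_nonneg (pow_nonneg ha.1.le n)]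
    · rw [Set.indicator_of_notMem ha]
      convert measure_empty (μ := (volume : Measure (Fin n → ℝ)))
      rw [Set.eq_empty_iff_forall_notMem]
      rintro z ⟨h1, -⟩
      exact ha h1
  rw [hpre, (volume_preserving_piFinSuccAbove (fun _ : Fin (n + 1) => ℝ) 0).measure_preimage_equiv,
    measure_congr (union_ae_eq_left_of_ae_eq_empty (ae_eq_empty.2 hZ0)), Measure.volume_eq_prod, Measure.prod_apply hSm]
  simp only [hslice]
  rw [lintegral_indicator measurableSet_Ioc, lintegral_mul_const _ (by fun_prop),
    ← ofReal_integral_eq_lintegral_ofReal, ← intervalIntegral.integral_of_le zero_le_one,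
    integral_pow]
  · have : ((1 : ℝ) ^ (n + 1) - 0 ^ (n + 1)) / (n + 1) = ((n + 1 : ℕ) : ℝ)⁻¹ := by
      simp
    rw [this, ENNReal.ofReal_inv_of_pos (by positivity), ENNReal.ofReal_natCast, mul_comm,
      ENNReal.div_eq_inv_mul, mul_comm]
  · exact (by fun_prop : Continuous fun a : ℝ => a ^ n).integrableOn_Icc.mono_set
      Set.Ioc_subset_Icc_self
  · refine (ae_restrict_iff' measurableSet_Ioc).2 (Filter.Eventually.of_forall fun a ha => ?_)
    exact pow_nonneg ha.1.le n

/-! ### Polytopes of trees and forests -/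

namespace PlaneForest

/-- For each node of `F`, in the order in which they become active, the number of successors and
the exponent of the rightmost one. -/
def blocks : PlaneForest → ℕ → List (ℕ × ℕ)
  | nil, _ => []
  | cons C R, j => (C.numTrees, j + R.numTrees) ::
      (C.blocks (j + R.numTrees) ++ R.blocks j)

/-- The coordinates of consecutive groups of siblings. -/
def placeBlocks : ℕ → List (ℕ × ℕ) → List (List (ℕ × ℕ))
  | _, [] => []
  | p, b :: l => siblings p b.2 b.1 :: placeBlocks (p + b.1) l

theorem placeBlocks_append (p : ℕ) (l l' : List (ℕ × ℕ)) :
    placeBlocks p (l ++ l') = placeBlocks p l ++ placeBlocks (p + (l.map Prod.fst).sum) l' := by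
  induction l generalizing p with
  | nil => simp [placeBlocks]
  | cons b l ih => simp [placeBlocks, ih, add_assoc]

theorem sum_blocks (F : PlaneForest) (j : ℕ) :
    ((F.blocks j).map Prod.fst).sum = F.numNonroot := by
  induction F generalizing j with
  | nil => rfl
  | cons C R ihC ihR =>
    simp [blocks, ihC, ihR, numNonroot, numNodes_eq C, add_assoc]

/-- Nodes are numbered in the order of visits and siblings are visited together, so the groups of
siblings occupy consecutive intervals of coordinates. -/
theorem successorCoords_eq (F : PlaneForest) (p j : ℕ) :
    F.successorCoords p j = placeBlocks p (F.blocks j) := by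
  induction F generalizing p j with
  | nil => rfl
  | cons C R ihC ihR =>
    simp only [successorCoords, blocks, placeBlocks, placeBlocks_append, ihC, ihR, sum_blocks,
      numNodes_eq C, add_assoc]

end PlaneForest

theorem forall_placeBlocks_congr (q : ℝ) {y y' : ℕ → ℝ} (b : ℝ) {p p' : ℕ} (l : List (ℕ × ℕ))
    (h : ∀ i < (l.map Prod.fst).sum, y (p + i) = y' (p' + i)) :
    (∀ L ∈ placeBlocks p l, sibChain q y b L) ↔ ∀ L ∈ placeBlocks p' l, sibChain q y' b L := by
  induction l generalizing p p' with
  | nil => simp [placeBlocks]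
  | cons c l ih =>
    simp only [List.map_cons, List.sum_cons] at h
    simp only [placeBlocks, List.forall_mem_cons]
    rw [sibChain_congr q b c.2 c.1 (y' := y') (p' := p') (fun i hi => h i (by omega)),
      ih (p' := p' + c.1)]
    intro i hi
    have := h (c.1 + i) (by omega)
    rwa [add_assoc, add_assoc]

theorem measurableSet_placeBlocks (q b : ℝ) (n p : ℕ) (l : List (ℕ × ℕ)) :
    MeasurableSet {x : Fin n → ℝ | ∀ L ∈ placeBlocks p l, sibChain q (entry x) b L} := by
  induction l generalizing p with
  | nil => simp [placeBlocks]
  | cons c l ih =>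
    simp only [placeBlocks, List.forall_mem_cons]
    exact (measurableSet_sibChain q measurable_entry measurable_const _ _ _).inter (ih _)

/-- Distinct groups constrain disjoint sets of coordinates, so the set is a product over the groups.
-/
theorem volume_placeBlocks {q : ℝ} (hq : 1 ≤ q) (n : ℕ) (l : List (ℕ × ℕ))
    (hn : (l.map Prod.fst).sum = n) :
    volume {x : Fin n → ℝ | ∀ L ∈ placeBlocks 0 l, sibChain q (entry x) q L} =
      ENNReal.ofReal (l.map fun c =>
        (q - 1) ^ c.1 / c.1 ! * q ^ (c.1 * c.2 + c.1.choose 2)).prod := by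
  induction l generalizing n with
  | nil =>
    simp only [List.map_nil, List.sum_nil] at hn
    subst hn
    simp [placeBlocks, volume_pi]
  | cons c l ih =>
    simp only [List.map_cons, List.sum_cons] at hn
    subst hn
    have h0 : 0 ≤ q - 1 := by linarith
    have hc : 0 ≤ (q - 1) ^ c.1 / c.1 ! * q ^ (c.1 * c.2 + c.1.choose 2) :=
      mul_nonneg (div_nonneg (pow_nonneg h0 _) (by positivity)) (pow_nonneg (by linarith) _)
    have hset : {x : Fin (c.1 + (l.map Prod.fst).sum) → ℝ |
        ∀ L ∈ placeBlocks 0 (c :: l), sibChain q (entry x) q L} =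
        prodSet {x : Fin c.1 → ℝ | sibChain q (entry x) q (siblings 0 c.2 c.1)}
          {x : Fin (l.map Prod.fst).sum → ℝ |
            ∀ L ∈ placeBlocks 0 l, sibChain q (entry x) q L} := by
      ext x
      simp only [placeBlocks, List.forall_mem_cons, prodSet, Set.mem_ofPred_eq]
      refine and_congr (sibChain_congr q q _ _ fun i hi => ?_)
        (forall_placeBlocks_congr q q l fun i hi => ?_)
      · simp only [entry, zero_add, dif_pos hi, dif_pos (hi.trans_le (Nat.le_add_right _ _))]
        rfl
      · simp only [entry, zero_add, dif_pos hi, dif_pos (Nat.add_lt_add_left hi c.1)]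
        rfl
    rw [hset, volume_prodSet, volume_sibChain (by linarith) _ _ hq, ih _ rfl, List.map_cons,
      List.prod_cons, ENNReal.ofReal_mul hc]

theorem PlaneForest.prod_blocks (F : PlaneForest) (q : ℝ) (j : ℕ) :
    ((F.blocks j).map fun c =>
      (q - 1) ^ c.1 / c.1 ! * q ^ (c.1 * c.2 + c.1.choose 2)).prod =
      (q - 1) ^ F.numNonroot * q ^ F.expSum j / F.degFact := by
  induction F generalizing j with
  | nil => simp [blocks, numNonroot, expSum, degFact]
  | cons C R ihC ihR =>
    simp only [blocks, List.map_cons, List.map_append, List.prod_cons, List.prod_append, ihC, ihR,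
      numNonroot, expSum, degFact, numNodes_eq C, Nat.cast_mul]
    have h1 := C.degFact_pos
    have h2 := R.degFact_pos
    simp only [pow_add]
    field_simp

theorem treePolytope_eq (t : ℝ) (C : PlaneForest) :
    treePolytope t C = {x | ∀ L ∈ placeBlocks 0 ((PlaneForest.cons C .nil).blocks 0),
      sibChain (1 + t) (entry x) (1 + t) L} := by
  simp only [treePolytope, successorCoords_eq, sibChain]

theorem measurableSet_treePolytope (t : ℝ) (C : PlaneForest) :
    MeasurableSet (treePolytope t C) := by
  rw [treePolytope_eq]
  exact measurableSet_placeBlocks _ _ _ _ _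

theorem volume_treePolytope {t : ℝ} (ht : 0 ≤ t) (C : PlaneForest) :
    volume (treePolytope t C) = ENNReal.ofReal (t ^ C.numNodes *
      (1 + t) ^ (PlaneForest.cons C .nil).expSum 0 / (PlaneForest.cons C .nil).degFact) := by
  rw [treePolytope_eq]
  refine (volume_placeBlocks (by linarith) C.numNodes _ (sum_blocks (.cons C .nil) 0)).trans ?_
  rw [prod_blocks, add_sub_cancel_left]
  rfl

/-- The cone over the polytope of the remaining components divides by its dimension, which by
`dim_succ` is their number of nodes; this produces `tailProd`. -/
theorem volume_forestPolytopeAux {t : ℝ} (ht : 0 ≤ t) : (F : PlaneForest) →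
    volume (forestPolytopeAux t F) = ENNReal.ofReal
      (t ^ F.numNonroot * (1 + t) ^ F.forestExp / F.degFact / F.tailProd) ∧
    MeasurableSet (forestPolytopeAux t F)
  | .nil => by
    have : volume (Set.univ : Set (Fin 0 → ℝ)) = 1 := by
      simp [volume_pi]
    refine ⟨this.trans ?_, MeasurableSet.univ⟩
    simp [numNonroot, forestExp, degFact, tailProd]
  | .cons C .nil => by
    refine ⟨?_, measurableSet_treePolytope t C⟩
    rw [forestPolytopeAux]
    refine (volume_treePolytope ht C).trans ?_
    simp [numNonroot, forestExp, tailProd]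
  | .cons C (.cons C' R) => by
    obtain ⟨ih, ihm⟩ := volume_forestPolytopeAux ht (.cons C' R)
    obtain ⟨h1, h2⟩ := volume_coneSet ihm
    refine ⟨?_, measurableSet_prodSet (measurableSet_treePolytope t C) h2⟩
    rw [forestPolytopeAux]
    refine (volume_prodSet _ _).trans ?_
    have hpos := (PlaneForest.cons C' R).tailProd_pos
    have hnum : 0 < (PlaneForest.cons C' R).numNodes := by simp only [numNodes]; omega
    rw [h1, ih, volume_treePolytope ht, PlaneForest.dim_succ, ← ENNReal.ofReal_natCast,
      ← ENNReal.ofReal_div_of_pos (by positivity), ← ENNReal.ofReal_mul (by positivity)]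
    congr 1
    have d1 := C.degFact_pos
    have d2 := (PlaneForest.cons C' R).degFact_pos
    rw [show (PlaneForest.cons C (.cons C' R)).numNonroot =
      C.numNodes + (PlaneForest.cons C' R).numNonroot from rfl,
      show (PlaneForest.cons C (.cons C' R)).forestExp =
      (PlaneForest.cons C .nil).expSum 0 + (PlaneForest.cons C' R).forestExp from rfl,
      show (PlaneForest.cons C (.cons C' R)).degFact =
      C.numTrees ! * C.degFact * (PlaneForest.cons C' R).degFact from rfl,
      show (PlaneForest.cons C .nil).degFact = C.numTrees ! * C.degFact * 1 from rfl,
      show (PlaneForest.cons C (.cons C' R)).tailProd =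
      (PlaneForest.cons C' R).numNodes * (PlaneForest.cons C' R).tailProd from rfl]
    push_cast
    rw [pow_add, pow_add]
    field_simp

theorem volume_forestPolytope {n : ℕ} {t : ℝ} (ht : 0 ≤ t) (F : PlaneForestOn (n + 1)) :
    volume (forestPolytope t F) = ENNReal.ofReal
      (t ^ F.1.numNonroot * (1 + t) ^ F.1.forestExp / F.1.degFact / F.1.tailProd) := by
  rw [← (volume_forestPolytopeAux ht F.1).1]
  have key : ∀ {m n : ℕ} (h : m = n) (S : Set (Fin m → ℝ)),
      volume {x : Fin n → ℝ | (fun i => x (Fin.cast h i)) ∈ S} = volume S := by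
    rintro m _ rfl S
    rfl
  exact key F.dim_eq _

/-! ### Depth sequences -/

/-- The inequalities that cut out the polytope with a given depth sequence.  The sequence `l`
belongs to the coordinates `x (p + 1), x (p + 2), …`; the depth `0` stands for a root, and `ρ` is
the index of the last root before `p + 1`. -/
def DepthIneq (q : ℝ) (x : ℕ → ℝ) : ℕ → ℕ → List ℕ → Prop
  | _, _, [] => True
  | ρ, p, 0 :: l => 0 ≤ x (p + 1) ∧ x (p + 1) ≤ x ρ ∧ x (p + 1) ≤ q * x p ∧
      DepthIneq q x (p + 1) (p + 1) l
  | ρ, p, (d + 1) :: l => q ^ d * x ρ ≤ x (p + 1) ∧ x (p + 1) ≤ q ^ (d + 1) * x ρ ∧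
      x (p + 1) ≤ q * x p ∧ DepthIneq q x ρ (p + 1) l

/-- Positive depths introduce no root, so `ρ` is the same for the second list. -/
theorem depthIneq_append {q : ℝ} {x : ℕ → ℝ} {ρ p : ℕ} {l l' : List ℕ} (hl : ∀ d ∈ l, 0 < d) :
    DepthIneq q x ρ p (l ++ l') ↔ DepthIneq q x ρ p l ∧ DepthIneq q x ρ (p + l.length) l' := by
  induction l generalizing p with
  | nil => simp [DepthIneq]
  | cons a l ih =>
    rw [List.forall_mem_cons] at hl
    obtain ⟨d, rfl⟩ : ∃ d, a = d + 1 := ⟨a - 1, by have := hl.1; omega⟩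
    simp only [List.cons_append, DepthIneq, ih hl.2, List.length_cons, and_assoc]
    rw [show p + 1 + l.length = p + (l.length + 1) by ring]

/-- The inequalities are homogeneous. This removes the factor `x₀` in a cone with `x₀ > 0`. -/
theorem depthIneq_scale {q : ℝ} {x x' : ℕ → ℝ} {ρ ρ' p p' : ℕ} {l : List ℕ} {c : ℝ} (hc : 0 < c)
    (hρ : x' ρ' = c * x ρ) (h : ∀ i ≤ l.length, x' (p' + i) = c * x (p + i)) :
    DepthIneq q x' ρ' p' l ↔ DepthIneq q x ρ p l := by
  induction l generalizing ρ ρ' p p' with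
  | nil => simp [DepthIneq]
  | cons a l ih =>
    have h0 : x' p' = c * x p := by simpa using h 0 (by simp)
    have h1 : x' (p' + 1) = c * x (p + 1) := h 1 (by simp)
    have h2 : ∀ i ≤ l.length, x' (p' + 1 + i) = c * x (p + 1 + i) := by
      intro i hi
      have := h (i + 1) (by simpa using hi)
      rwa [show p' + 1 + i = p' + (i + 1) by ring, show p + 1 + i = p + (i + 1) by ring]
    have e : ∀ a b : ℝ, a * (c * b) = c * (a * b) := fun a b => by ring
    cases a with
    | zero =>
      simp only [DepthIneq, ih h1 h2, h0, h1, hρ, e, mul_le_mul_iff_right₀ hc,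
        mul_nonneg_iff_of_pos_left hc]
    | succ d =>
      simp only [DepthIneq, ih hρ h2, h0, h1, hρ, e, mul_le_mul_iff_right₀ hc]

theorem depthIneq_nonneg {q : ℝ} (hq : 0 ≤ q) {x : ℕ → ℝ} {ρ p : ℕ} {l : List ℕ}
    (h : DepthIneq q x ρ p l) (hρ : 0 ≤ x ρ) : ∀ i < l.length, 0 ≤ x (p + 1 + i) := by
  induction l generalizing ρ p with
  | nil => simp
  | cons a l ih =>
    have key : 0 ≤ x (p + 1) ∧ ∀ i < l.length, 0 ≤ x (p + 1 + 1 + i) := by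
      cases a with
      | zero => exact ⟨h.1, ih h.2.2.2 h.1⟩
      | succ d =>
        exact ⟨(mul_nonneg (pow_nonneg hq _) hρ).trans h.1, ih h.2.2.2 hρ⟩
    intro i hi
    cases i with
    | zero => exact key.1
    | succ i =>
      have := key.2 i (by simpa using hi)
      rwa [show p + 1 + (i + 1) = p + 1 + 1 + i by ring]

theorem depthIneq_le {q : ℝ} {x : ℕ → ℝ} {ρ p : ℕ} {l : List ℕ}
    (h : DepthIneq q x ρ p l) : ∀ i < l.length, x (p + 1 + i) ≤ q * x (p + i) := by
  induction l generalizing ρ p with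
  | nil => simp
  | cons a l ih =>
    have key : x (p + 1) ≤ q * x p ∧ ∀ i < l.length, x (p + 1 + 1 + i) ≤ q * x (p + 1 + i) := by
      cases a with
      | zero => exact ⟨h.2.2.1, ih h.2.2.2⟩
      | succ d => exact ⟨h.2.2.1, ih h.2.2.2⟩
    intro i hi
    cases i with
    | zero => exact key.1
    | succ i =>
      have := key.2 i (by simpa using hi)
      rwa [show p + 1 + (i + 1) = p + 1 + 1 + i by ring, show p + (i + 1) = p + 1 + i by ring]

/-- The apex of a cone: a root coordinate `0` forces all later coordinates to vanish. -/
theorem depthIneq_eq_zero {q : ℝ} {x : ℕ → ℝ} {ρ p : ℕ} {l : List ℕ}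
    (h : DepthIneq q x ρ p l) (hρ : x ρ = 0) : ∀ i < l.length, x (p + 1 + i) = 0 := by
  induction l generalizing ρ p with
  | nil => simp
  | cons a l ih =>
    have key : x (p + 1) = 0 ∧ ∀ i < l.length, x (p + 1 + 1 + i) = 0 := by
      cases a with
      | zero =>
        have h1 : x (p + 1) = 0 := le_antisymm (h.2.1.trans_eq hρ) h.1
        exact ⟨h1, ih h.2.2.2 h1⟩
      | succ d =>
        have h1 := h.1
        have h2 := h.2.1
        rw [hρ, mul_zero] at h1 h2
        exact ⟨le_antisymm h2 h1, ih h.2.2.2 hρ⟩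
    intro i hi
    cases i with
    | zero => exact key.1
    | succ i =>
      have := key.2 i (by simpa using hi)
      rwa [show p + 1 + (i + 1) = p + 1 + 1 + i by ring]

theorem depthIneq_of_eq_zero {q : ℝ} {x : ℕ → ℝ} {ρ p : ℕ} {l : List ℕ} (hρ : x ρ = 0)
    (h : ∀ i ≤ l.length, x (p + i) = 0) : DepthIneq q x ρ p l := by
  induction l generalizing ρ p with
  | nil => trivial
  | cons a l ih =>
    have h0 : x p = 0 := by simpa using h 0 (by simp)
    have h1 : x (p + 1) = 0 := h 1 (by simp)
    have h2 : ∀ i ≤ l.length, x (p + 1 + i) = 0 := by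
      intro i hi
      have := h (i + 1) (by simpa using hi)
      rwa [show p + 1 + i = p + (i + 1) by ring]
    cases a with
    | zero => simp [DepthIneq, h0, h1, hρ, ih h1 h2]
    | succ d => simp [DepthIneq, h0, h1, hρ, ih hρ h2]

theorem depthIneq_one_of_eq_one {x : ℕ → ℝ} {ρ p : ℕ} {l : List ℕ} (hρ : x ρ = 1)
    (h : ∀ i ≤ l.length, x (p + i) = 1) : DepthIneq 1 x ρ p l := by
  induction l generalizing ρ p with
  | nil => trivial
  | cons a l ih =>
    have h0 : x p = 1 := by simpa using h 0 (by simp)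
    have h1 : x (p + 1) = 1 := h 1 (by simp)
    have h2 : ∀ i ≤ l.length, x (p + 1 + i) = 1 := by
      intro i hi
      have := h (i + 1) (by simpa using hi)
      rwa [show p + 1 + i = p + (i + 1) by ring]
    cases a with
    | zero => simp [DepthIneq, h0, h1, hρ, ih h1 h2]
    | succ d => simp [DepthIneq, h0, h1, hρ, ih hρ h2]

theorem le_of_depthIneq_range' {q : ℝ} {x : ℕ → ℝ} {ρ p j k : ℕ} (hρ : x ρ = 1)
    (h : DepthIneq q x ρ p (List.range' (j + 1) k)) :
    ∀ i < k, q ^ (j + i) ≤ x (p + 1 + i) := by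
  induction k generalizing p j with
  | zero => simp
  | succ k ih =>
    rw [List.range'_succ] at h
    obtain ⟨h1, -, -, h2⟩ := h
    intro i hi
    cases i with
    | zero => simpa [hρ] using h1
    | succ i =>
      have := ih h2 i (by omega)
      rwa [show p + 1 + (i + 1) = p + 1 + 1 + i by ring, show j + (i + 1) = j + 1 + i by ring]

/-- After clearing denominators, the inequality between neighboring siblings is `xᵢ₊₁ ≤ q * xᵢ`, and
the ends `1` and `b ≤ q` of the chain confine each coordinate to the range of its depth. The
hypothesis on `x p` makes `x (p + 1) ≤ q * x p` a consequence for the first sibling visited. -/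
theorem sibChain_iff_depthIneq {q : ℝ} (hq : 0 < q) {x : ℕ → ℝ} {ρ p j k : ℕ} {b : ℝ}
    (hρ : x ρ = 1) (hb : 1 ≤ b) (hbq : b ≤ q) (hp : q ^ j * b ≤ q * x p) :
    sibChain q x b (siblings (p + 1) j k) ↔
      DepthIneq q x ρ p (List.range' (j + 1) k) ∧ (0 < k → x (p + 1) ≤ q ^ j * b) := by
  induction k generalizing p j b with
  | zero => simp [sibChain_zero, hb, DepthIneq]
  | succ k ih =>
    have hj : 0 < q ^ j := by positivity
    rw [sibChain_succ, List.range'_succ]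
    simp only [DepthIneq, hρ, mul_one]
    have hprev : q ^ (j + 1) * (x (p + 1) / q ^ j) ≤ q * x (p + 1) := by
      rw [pow_succ]; field_simp; rfl
    constructor
    · rintro ⟨h1, h2⟩
      have hb' := sibChain_one_le h1
      have h3 := ((ih hb' (h2.trans hbq) hprev).1 h1).1
      rw [one_le_div hj] at hb'
      rw [div_le_iff₀' hj] at h2
      refine ⟨⟨hb', ?_, h2.trans hp, h3⟩, fun _ => h2⟩
      rw [pow_succ]
      exact h2.trans (mul_le_mul_of_nonneg_left hbq hj.le)
    · rintro ⟨⟨h1, h2, h3, h4⟩, h5⟩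
      have h6 := h5 (Nat.succ_pos k)
      rw [← div_le_iff₀' hj] at h6
      refine ⟨(ih ((one_le_div hj).2 h1) (h6.trans hbq) hprev).2 ⟨h4, fun hk => ?_⟩, h6⟩
      have := depthIneq_le h4 0 (by simpa using hk)
      simp only [add_zero] at this
      rw [pow_succ]
      field_simp
      simpa [mul_comm] using this

namespace PlaneForest

/-- The depths (one plus the exponents) of the nodes of a forest that are not roots, in the order
in which they are visited, if the leftmost node becomes active when the exponent of its parent
is `j`. -/
def innerDepths : PlaneForest → ℕ → List ℕ
  | nil, _ => []
  | cons C R, j => List.range' (j + R.numTrees + 1) C.numTrees ++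
      (C.innerDepths (j + R.numTrees) ++ R.innerDepths j)

/-- The depth sequence of a forest. -/
def depths : PlaneForest → List ℕ
  | nil => []
  | cons C R => 0 :: ((cons C nil).innerDepths 0 ++ R.depths)

theorem length_innerDepths (F : PlaneForest) (j : ℕ) :
    (F.innerDepths j).length = F.numNonroot := by
  induction F generalizing j with
  | nil => rfl
  | cons C R ihC ihR => simp [innerDepths, ihC, ihR, numNonroot, numNodes_eq C, add_assoc]

theorem length_depths (F : PlaneForest) : F.depths.length = F.numNodes := by
  induction F with
  | nil => rfl
  | cons C R _ ihR =>
    simp only [depths, List.length_cons, List.length_append, length_innerDepths, ihR, numNonroot,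
      numNodes]
    omega

theorem lt_of_mem_innerDepths {F : PlaneForest} {j d : ℕ} (h : d ∈ F.innerDepths j) : j < d := by
  induction F generalizing j with
  | nil => simp [innerDepths] at h
  | cons C R ihC ihR =>
    simp only [innerDepths, List.mem_append, List.mem_range'_1] at h
    rcases h with h | h | h
    · omega
    · have := ihC h; omega
    · exact ihR h

/-- Between the groups of siblings, `DepthIneq` contains inequalities `x (p + 1) ≤ q * x p` that the
chains do not mention. They are redundant because the last visited coordinate is always at least `q`
to the exponent of the next active node; `hp` and the second claim carry this invariant through the
induction. -/
theorem forall_blocks_iff {q : ℝ} (hq : 1 ≤ q) {x : ℕ → ℝ} {ρ p j : ℕ} (F : PlaneForest)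
    (hρ : x ρ = 1) (hp : ∀ m, F.numTrees = m + 1 → q ^ (j + m) ≤ x p) :
    ((∀ L ∈ placeBlocks (p + 1) (F.blocks j), sibChain q x q L) ↔
      DepthIneq q x ρ p (F.innerDepths j)) ∧
    (DepthIneq q x ρ p (F.innerDepths j) → 0 < F.numTrees → q ^ j ≤ x (p + F.numNonroot)) := by
  induction F generalizing p j with
  | nil => simp [blocks, innerDepths, placeBlocks, DepthIneq, numTrees]
  | cons C R ihC ihR =>
    have hq0 : 0 < q := by linarith
    have hp0 : q ^ (j + R.numTrees) ≤ x p := hp _ rfl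
    have hsib := sibChain_iff_depthIneq hq0 (p := p) (j := j + R.numTrees) (k := C.numTrees)
      (b := q) hρ hq le_rfl (by rw [mul_comm]; exact mul_le_mul_of_nonneg_left hp0 hq0.le)
    -- For `b = q` the extra bound on the first sibling is the upper bound of its depth.
    have hsib' : sibChain q x q (siblings (p + 1) (j + R.numTrees) C.numTrees) ↔
        DepthIneq q x ρ p (List.range' (j + R.numTrees + 1) C.numTrees) := by
      rw [hsib, and_iff_left_iff_imp]
      intro h hk
      obtain ⟨k, hk⟩ : ∃ k, C.numTrees = k + 1 := ⟨C.numTrees - 1, by omega⟩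
      rw [hk, List.range'_succ] at h
      have := h.2.1
      rwa [hρ, mul_one, pow_succ] at this
    have hpC : DepthIneq q x ρ p (List.range' (j + R.numTrees + 1) C.numTrees) →
        ∀ m, C.numTrees = m + 1 → q ^ (j + R.numTrees + m) ≤ x (p + C.numTrees) := by
      intro h m hm
      have := le_of_depthIneq_range' hρ h m (by omega)
      rwa [show p + 1 + m = p + C.numTrees by omega] at this
    have hpR : DepthIneq q x ρ p (List.range' (j + R.numTrees + 1) C.numTrees) →
        DepthIneq q x ρ (p + C.numTrees) (C.innerDepths (j + R.numTrees)) →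
        q ^ (j + R.numTrees) ≤ x (p + C.numNodes) := by
      intro h1 h2
      by_cases hC : 0 < C.numTrees
      · have := (ihC (hpC h1)).2 h2 hC
        rwa [numNodes_eq, ← add_assoc]
      · cases C with
        | nil => simpa [numNodes] using hp0
        | cons C R => simp [numTrees] at hC
    have hpR' : DepthIneq q x ρ p (List.range' (j + R.numTrees + 1) C.numTrees) →
        DepthIneq q x ρ (p + C.numTrees) (C.innerDepths (j + R.numTrees)) →
        ∀ m, R.numTrees = m + 1 → q ^ (j + m) ≤ x (p + C.numNodes) := by
      intro h1 h2 m hm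
      exact (pow_le_pow_right₀ hq (by omega)).trans (hpR h1 h2)
    have hD : DepthIneq q x ρ p ((cons C R).innerDepths j) ↔
        DepthIneq q x ρ p (List.range' (j + R.numTrees + 1) C.numTrees) ∧
        DepthIneq q x ρ (p + C.numTrees) (C.innerDepths (j + R.numTrees)) ∧
        DepthIneq q x ρ (p + C.numNodes) (R.innerDepths j) := by
      rw [innerDepths, depthIneq_append (fun d hd => by
        rw [List.mem_range'_1] at hd; omega), List.length_range', depthIneq_append (fun d hd => by
        have := lt_of_mem_innerDepths hd; omega), length_innerDepths, add_assoc p,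
        ← numNodes_eq]
    constructor
    · rw [hD]
      simp only [blocks, placeBlocks, placeBlocks_append, sum_blocks, List.forall_mem_cons,
        List.forall_mem_append, hsib']
      refine and_congr_right fun h1 => ?_
      have e1 : p + 1 + C.numTrees = p + C.numTrees + 1 := by ring
      have e2 : p + 1 + C.numTrees + C.numNonroot = p + C.numNodes + 1 := by
        rw [numNodes_eq]; ring
      rw [e2, e1, (ihC (hpC h1)).1]
      refine and_congr_right fun h2 => ?_
      rw [(ihR (hpR' h1 h2)).1]
    · rw [hD]
      rintro ⟨h1, h2, h3⟩ -
      rw [numNonroot, ← add_assoc]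
      by_cases hR : 0 < R.numTrees
      · exact (ihR (hpR' h1 h2)).2 h3 hR
      · have h4 := hpR h1 h2
        cases R with
        | nil => simpa [numNonroot, numTrees] using h4
        | cons C R => simp [numTrees] at hR

end PlaneForest

/-- The coordinates `1, x₁, x₂, …` of a point, continued by zeros. -/
def coords {n : ℕ} (x : Fin n → ℝ) : ℕ → ℝ
  | 0 => 1
  | i + 1 => entry x i

theorem mem_treePolytope_iff {t : ℝ} (ht : 0 ≤ t) {C : PlaneForest} {z : Fin C.numNodes → ℝ}
    {x : ℕ → ℝ} (hx : ∀ i ≤ C.numNodes, x i = coords z i) :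
    z ∈ treePolytope t C ↔ DepthIneq (1 + t) x 0 0 ((PlaneForest.cons C .nil).innerDepths 0) := by
  have h0 : x 0 = 1 := hx 0 (Nat.zero_le _)
  rw [← (forall_blocks_iff (by linarith) (.cons C .nil) h0 (fun m hm => by
    simp only [numTrees, zero_add, Nat.right_eq_add] at hm
    simp [hm, h0])).1, treePolytope_eq]
  refine forall_placeBlocks_congr _ _ _ fun i hi => ?_
  rw [sum_blocks] at hi
  rw [zero_add, zero_add, add_comm, hx _ hi]
  rfl

/-- The last coordinate of the first component is at least `1`, which makes the step inequality at
the next root redundant. -/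
theorem le_of_depthIneq_tree {q : ℝ} (hq : 1 ≤ q) {C : PlaneForest} {x : ℕ → ℝ} (h0 : x 0 = 1)
    (h : DepthIneq q x 0 0 ((PlaneForest.cons C .nil).innerDepths 0)) : 1 ≤ x C.numNodes := by
  have := (forall_blocks_iff hq (.cons C .nil) h0 (fun m hm => by
    simp only [numTrees, zero_add, Nat.right_eq_add] at hm
    simp [hm, h0])).2 h (by simp [numTrees])
  simpa [numNonroot] using this

/-- Needed at the apex: a cone contains the origin only if its base is nonempty. For `t = 0` the
volume may vanish, so a point is exhibited, with ones in the trees and zeros in the cones. -/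
theorem forestPolytopeAux_nonempty {t : ℝ} (ht : 0 ≤ t) (F : PlaneForest) :
    (forestPolytopeAux t F).Nonempty := by
  rcases ht.eq_or_lt with rfl | ht'
  · have htree : ∀ C, (treePolytope 0 C).Nonempty := fun C => by
      refine ⟨fun _ => 1, (mem_treePolytope_iff le_rfl (x := coords fun _ => 1)
        fun _ _ => rfl).2 ?_⟩
      rw [add_zero]
      refine depthIneq_one_of_eq_one rfl fun i hi => ?_
      rw [length_innerDepths] at hi
      rw [zero_add]
      cases i with
      | zero => rfl
      | succ i => exact dif_pos hi
    have key : ∀ C R, (forestPolytopeAux 0 (.cons C R)).Nonempty := by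
      intro C R
      induction R generalizing C with
      | nil => exact htree C
      | cons C' R _ ih =>
        obtain ⟨z, hz⟩ := htree C
        obtain ⟨y, hy⟩ := ih C'
        refine ⟨Fin.append z 0, ?_, ?_⟩
        · simpa using hz
        · refine ⟨by simp, by simp, y, hy, ?_⟩
          ext i
          simp [Fin.tail]
    cases F with
    | nil => exact Set.univ_nonempty
    | cons C R => exact key C R
  · refine nonempty_of_measure_ne_zero (μ := volume) ?_
    rw [(volume_forestPolytopeAux ht F).1]
    have h1 := F.degFact_pos
    have h2 := F.tailProd_pos
    exact (ENNReal.ofReal_pos.2 (by positivity)).ne'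

/-- The cone coordinate `x₀` is the coordinate of the next root. If it is positive, dividing by it
reduces to the remaining forest; if it is zero, both sides say that all later coordinates vanish. -/
theorem mem_forestPolytopeAux_iff {t : ℝ} (ht : 0 ≤ t) (C R : PlaneForest)
    (z : Fin (PlaneForest.cons C R).dim → ℝ) :
    z ∈ forestPolytopeAux t (.cons C R) ↔
      DepthIneq (1 + t) (coords z) 0 0 (PlaneForest.cons C R).depths.tail := by
  induction R generalizing C with
  | nil =>
    simp only [depths, List.tail_cons, List.append_nil]
    exact mem_treePolytope_iff ht fun _ _ => rfl
  | cons C' R _ ih =>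
    have hdim : (PlaneForest.cons C (.cons C' R)).dim =
      C.numNodes + ((PlaneForest.cons C' R).dim + 1) := rfl
    set x := coords z with hx
    set D := (PlaneForest.cons C' R).dim with hD
    set z1 : Fin C.numNodes → ℝ := fun i => z (Fin.castAdd (D + 1) i) with hz1
    set z2 : Fin (D + 1) → ℝ := fun i => z (Fin.natAdd C.numNodes i) with hz2
    have hx1 : ∀ i ≤ C.numNodes, x i = coords z1 i := by
      intro i hi
      cases i with
      | zero => rfl
      | succ i =>
        have hi' : i < C.numNodes := hi
        exact (entry_val z ⟨i, by omega⟩).trans (entry_val z1 ⟨i, hi'⟩).symm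
    have hx2 : ∀ i ≤ D, x (C.numNodes + 1 + i) = entry z2 i := by
      intro i hi
      have hi' : i < D + 1 := Nat.lt_succ_of_le hi
      rw [show C.numNodes + 1 + i = C.numNodes + i + 1 by ring]
      exact (entry_val z ⟨C.numNodes + i, by omega⟩).trans (entry_val z2 ⟨i, hi'⟩).symm
    have hx20 : x (C.numNodes + 1) = z2 0 := by
      exact (hx2 0 (Nat.zero_le _)).trans (entry_zero z2)
    have hlen : (PlaneForest.cons C' R).depths.tail.length = D := by
      rw [List.length_tail, length_depths, ← PlaneForest.dim_succ]; rfl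
    have hcone : z2 ∈ coneSet (forestPolytopeAux t (.cons C' R)) ↔
        0 ≤ x (C.numNodes + 1) ∧ x (C.numNodes + 1) ≤ 1 ∧
        DepthIneq (1 + t) x (C.numNodes + 1) (C.numNodes + 1)
          (PlaneForest.cons C' R).depths.tail := by
      rw [hx20]
      refine and_congr_right fun h0 => and_congr_right fun h1 => ?_
      rcases h0.eq_or_lt with h0 | h0
      · constructor
        · rintro ⟨y, -, hy⟩
          rw [← h0, zero_smul] at hy
          refine depthIneq_of_eq_zero (hx20.trans h0.symm) fun i hi => ?_
          rw [hlen] at hi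
          rw [hx2 i hi]
          cases i with
          | zero => rw [entry_zero, h0]
          | succ i => rw [entry_succ, hy]; simp [entry]
        · intro h
          obtain ⟨y, hy⟩ := forestPolytopeAux_nonempty ht (.cons C' R)
          refine ⟨y, hy, ?_⟩
          rw [← h0, zero_smul]
          ext i
          have := depthIneq_eq_zero h (hx20.trans h0.symm) i (by rw [hlen]; exact i.2)
          rw [add_assoc, add_comm 1, hx2 _ i.2, entry_succ, entry_val] at this
          exact this
      · have hy : ∀ y, Fin.tail z2 = z2 0 • y →
            (y ∈ forestPolytopeAux t (.cons C' R) ↔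
            DepthIneq (1 + t) x (C.numNodes + 1) (C.numNodes + 1)
              (PlaneForest.cons C' R).depths.tail) := by
          intro y hy
          rw [ih]
          refine (depthIneq_scale (x := coords y) (x' := x) (ρ := 0) (p := 0) h0 ?_ ?_).symm
          · simp [coords, hx20]
          · intro i hi
            rw [hlen] at hi
            rw [hx2 i hi, zero_add]
            cases i with
            | zero => simp [coords, entry_zero]
            | succ i =>
              have hi' : i < D := hi
              rw [entry_succ, hy]
              simp only [coords, entry]
              rw [dif_pos hi', dif_pos hi']
              simp
        constructor
        · rintro ⟨y, hyP, hyz⟩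
          exact (hy y hyz).1 hyP
        · intro h
          have e : Fin.tail z2 = z2 0 • ((z2 0)⁻¹ • Fin.tail z2) := by
            rw [smul_inv_smul₀ h0.ne']
          exact ⟨_, (hy _ e).2 h, e⟩
    have hmem : z ∈ forestPolytopeAux t (.cons C (.cons C' R)) ↔
        z1 ∈ treePolytope t C ∧ z2 ∈ coneSet (forestPolytopeAux t (.cons C' R)) := Iff.rfl
    rw [hmem, mem_treePolytope_iff ht hx1, hcone]
    have hdep : (PlaneForest.cons C (.cons C' R)).depths.tail =
      (PlaneForest.cons C .nil).innerDepths 0 ++ 0 :: (PlaneForest.cons C' R).depths.tail := rfl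
    rw [hdep, depthIneq_append (fun d hd => lt_of_mem_innerDepths hd), length_innerDepths]
    have e : 0 + (PlaneForest.cons C .nil).numNonroot = C.numNodes := by simp [numNonroot]
    rw [e]
    refine and_congr_right fun h => ?_
    simp only [DepthIneq]
    refine and_congr_right fun h0 => and_congr_right fun h1 => ?_
    -- The step inequality at the new root is automatic: its coordinate is at most `1`, and the
    -- preceding one is at least `1`.
    rw [and_iff_right]
    have h2 := le_of_depthIneq_tree (by linarith) (by rfl) h
    have h3 : x 0 = 1 := rfl
    nlinarith

theorem mem_forestPolytope_iff {n : ℕ} {t : ℝ} (ht : 0 ≤ t) (F : PlaneForestOn (n + 1))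
    (x : Fin n → ℝ) :
    x ∈ forestPolytope t F ↔ DepthIneq (1 + t) (coords x) 0 0 F.1.depths.tail := by
  have key : ∀ {m n : ℕ} (h : m = n) (x : Fin n → ℝ),
      coords (fun i => x (Fin.cast h i)) = coords x := by
    rintro m _ rfl x
    rfl
  obtain ⟨F, hF⟩ := F
  cases F with
  | nil => simp [numNodes] at hF
  | cons C R =>
    rw [← key (PlaneForestOn.dim_eq ⟨.cons C R, hF⟩) x]
    exact mem_forestPolytopeAux_iff ht C R _

namespace PlaneForest

/-! ### Forests and their depth sequences -/

/-- Add a rightmost tree, whose forest of subtrees at the root is `C`. -/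
def snoc : PlaneForest → PlaneForest → PlaneForest
  | nil, C => cons C nil
  | cons D R, C => cons D (R.snoc C)

theorem exists_eq_snoc (C R : PlaneForest) : ∃ F D, cons C R = snoc F D ∧
    F.numNodes + D.numNodes < (cons C R).numNodes := by
  induction R generalizing C with
  | nil => exact ⟨nil, C, rfl, by simp [numNodes]⟩
  | cons C' R _ ih =>
    obtain ⟨F, D, h, hlt⟩ := ih C'
    refine ⟨cons C F, D, by rw [h]; rfl, ?_⟩
    simp only [numNodes] at hlt ⊢
    omega

theorem numTrees_snoc (F C : PlaneForest) : (F.snoc C).numTrees = F.numTrees + 1 := by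
  induction F with
  | nil => rfl
  | cons D R _ ih => simp [snoc, numTrees, ih]

/-- The depths of all nodes of a forest of siblings, in the order in which they are visited. -/
def siblingDepths (F : PlaneForest) (j : ℕ) : List ℕ :=
  List.range' (j + 1) F.numTrees ++ F.innerDepths j

theorem siblingDepths_nil (j : ℕ) : siblingDepths nil j = [] := rfl

/-- The rightmost root is visited first and waits while the other siblings and their descendants are
treated, which raises their depths by one; only then do its own successors follow. This recursion
reads the depth list from its head. -/
theorem siblingDepths_snoc (F C : PlaneForest) (j : ℕ) :
    (F.snoc C).siblingDepths j = (j + 1) :: (F.siblingDepths (j + 1) ++ C.siblingDepths j) := by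
  have h : ∀ F : PlaneForest, (F.snoc C).innerDepths j =
      F.innerDepths (j + 1) ++ C.siblingDepths j := by
    intro F
    induction F with
    | nil => simp [snoc, innerDepths, siblingDepths, numTrees]
    | cons D R _ ih =>
      simp only [snoc, innerDepths, ih, numTrees_snoc, List.append_assoc]
      rw [show j + 1 + R.numTrees = j + (R.numTrees + 1) by ring]
  simp only [siblingDepths, h, numTrees_snoc, List.range'_succ, List.cons_append,
    List.append_assoc]

theorem depths_cons (C R : PlaneForest) :
    (cons C R).depths = 0 :: (C.siblingDepths 0 ++ R.depths) := by
  simp [depths, innerDepths, siblingDepths, numTrees]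

/-- Reconstruct a forest from its depth sequence. -/
def ofDepths : List ℕ → (ℕ → PlaneForest) × PlaneForest
  | [] => (fun _ => nil, nil)
  | 0 :: l => (fun _ => nil, cons ((ofDepths l).1 0) (ofDepths l).2)
  | (a + 1) :: l => (fun i => if i = a then snoc ((ofDepths l).1 (a + 1)) ((ofDepths l).1 a)
      else if i < a then (ofDepths l).1 i else nil, (ofDepths l).2)

/-- The list is decoded from its end, with one pending forest per level. An entry `a + 1` merges the
forests at levels `a + 1` and `a` by `snoc`, inverting `siblingDepths_snoc`. -/
theorem ofDepths_siblingDepths_append (F : PlaneForest) (j : ℕ) (l : List ℕ)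
    (h : ∀ i, j ≤ i → (ofDepths l).1 i = nil) :
    ofDepths (F.siblingDepths j ++ l) = (Function.update (ofDepths l).1 j F, (ofDepths l).2) := by
  induction hn : F.numNodes using Nat.strong_induction_on generalizing F j l with
  | _ n ih =>
    cases F with
    | nil =>
      rw [siblingDepths_nil, List.nil_append, ← h j le_rfl, Function.update_eq_self]
    | cons C R =>
      obtain ⟨F, D, e, hlt⟩ := exists_eq_snoc C R
      rw [e] at hn hlt ⊢
      rw [siblingDepths_snoc, List.cons_append, List.append_assoc]
      have h1 := ih D.numNodes (by omega) D j l h rfl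
      have h2 := ih F.numNodes (by omega) F (j + 1) (D.siblingDepths j ++ l) (by
        intro i hi
        rw [h1]
        exact (Function.update_of_ne (by omega) _ _).trans (h i (by omega))) rfl
      simp only [ofDepths, h2, h1, Prod.mk.injEq, and_true]
      ext1 i
      rcases lt_trichotomy i j with hi | rfl | hi
      · have hi' : i ≠ j + 1 := by omega
        simp [hi, hi.ne, hi']
      · simp
      · simp [hi.ne', not_lt.2 hi.le, h i hi.le]

theorem ofDepths_depths (F : PlaneForest) : ofDepths F.depths = (fun _ => nil, F) := by
  induction F with
  | nil => rfl
  | cons C R _ ih =>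
    rw [depths_cons, ofDepths, ofDepths_siblingDepths_append _ _ _ (by simp [ih]), ih]
    simp

theorem depths_injective : Function.Injective depths := by
  intro F G h
  have := ofDepths_depths F
  rw [h, ofDepths_depths] at this
  exact (Prod.ext_iff.1 this).2.symm

/-- A list of depths can follow a node of depth `d`: no entry exceeds the preceding one by more
than one. -/
def IsDepthList : ℕ → List ℕ → Prop
  | _, [] => True
  | d, a :: l => a ≤ d + 1 ∧ IsDepthList a l

/-- The depths of the nodes of a stack of forests of siblings. -/
def stackDepths : List PlaneForest → List ℕ
  | [] => []
  | F :: S => F.siblingDepths S.length ++ stackDepths S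

theorem stackDepths_replicate_append (k : ℕ) (S : List PlaneForest) :
    stackDepths (List.replicate k nil ++ S) = stackDepths S := by
  induction k with
  | zero => rfl
  | succ k ih => simp [List.replicate_succ, stackDepths, siblingDepths_nil, ih]

/-- What follows a node of depth `d` fills the levels `d, …, 0` with forests of siblings and ends
with the remaining components. -/
theorem exists_stack_of_isDepthList (l : List ℕ) (d : ℕ) (h : IsDepthList d l) :
    ∃ (S : List PlaneForest) (R : PlaneForest), S.length = d + 1 ∧
      l = stackDepths S ++ R.depths := by
  induction l generalizing d with
  | nil =>
    refine ⟨List.replicate (d + 1) nil, nil, by simp, ?_⟩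
    have := stackDepths_replicate_append (d + 1) []
    rw [List.append_nil] at this
    simp [this, stackDepths, depths]
  | cons a l ih =>
    obtain ⟨ha, hl⟩ := h
    obtain ⟨S, R, hS, rfl⟩ := ih a hl
    cases S with
    | nil => simp at hS
    | cons F S =>
      simp only [List.length_cons, Nat.add_right_cancel_iff] at hS
      cases a with
      | zero =>
        obtain rfl := List.eq_nil_of_length_eq_zero hS
        -- An entry `0` starts a component whose root has `F` below it, so all current levels are
        -- empty.
        refine ⟨List.replicate (d + 1) nil, cons F R, by simp, ?_⟩
        have := stackDepths_replicate_append (d + 1) []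
        rw [List.append_nil] at this
        simp [this, stackDepths, depths_cons]
      | succ a =>
        cases S with
        | nil => simp at hS
        | cons C S =>
          simp only [List.length_cons, Nat.add_right_cancel_iff] at hS
          -- The levels above `a` are empty; that `a ≤ d` is the condition on depth lists.
          refine ⟨List.replicate (d - a) nil ++ (F.snoc C :: S), R, ?_, ?_⟩
          · simp [hS]; omega
          · rw [stackDepths_replicate_append]
            simp [stackDepths, siblingDepths_snoc, hS]

theorem exists_depths_eq (l : List ℕ) (h : IsDepthList 0 l) :
    ∃ F : PlaneForest, F.depths = 0 :: l := by
  obtain ⟨S, R, hS, rfl⟩ := exists_stack_of_isDepthList l 0 h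
  match S, hS with
  | [C], _ => exact ⟨cons C R, by simp [depths_cons, stackDepths]⟩

theorem finite_numNodes_le (N : ℕ) : {F : PlaneForest | F.numNodes ≤ N}.Finite := by
  induction N with
  | zero =>
    refine (Set.finite_singleton nil).subset fun F hF => ?_
    cases F with
    | nil => rfl
    | cons C R =>
      have : (cons C R).numNodes ≤ 0 := hF
      simp only [numNodes] at this
      omega
  | succ N ih =>
    refine ((Set.finite_singleton nil).union (ih.image2 cons ih)).subset fun F hF => ?_
    cases F with
    | nil => left; rfl
    | cons C R =>
      right
      have : (cons C R).numNodes ≤ N + 1 := hF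
      simp only [numNodes] at this
      exact ⟨C, by change C.numNodes ≤ N; omega, R, by change R.numNodes ≤ N; omega, rfl⟩

instance finite_planeForestOn (N : ℕ) : Finite (PlaneForestOn N) :=
  ((finite_numNodes_le N).subset fun _ h => le_of_eq h).to_subtype

end PlaneForest

/-! ### Faces -/

/-- The inequalities for one coordinate of a given depth. -/
def DepthHead (q : ℝ) (x : ℕ → ℝ) (ρ p : ℕ) : ℕ → Prop
  | 0 => 0 ≤ x (p + 1) ∧ x (p + 1) ≤ x ρ ∧ x (p + 1) ≤ q * x p
  | d + 1 => q ^ d * x ρ ≤ x (p + 1) ∧ x (p + 1) ≤ q ^ (d + 1) * x ρ ∧ x (p + 1) ≤ q * x p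

/-- The index of the last root after a coordinate of depth `a` with index `p + 1`. -/
def nextRoot (ρ p a : ℕ) : ℕ := if a = 0 then p + 1 else ρ

theorem depthIneq_cons {q : ℝ} {x : ℕ → ℝ} {ρ p a : ℕ} {l : List ℕ} :
    DepthIneq q x ρ p (a :: l) ↔
      DepthHead q x ρ p a ∧ DepthIneq q x (nextRoot ρ p a) (p + 1) l := by
  cases a <;> simp [DepthIneq, DepthHead, nextRoot, and_assoc]

theorem DepthHead.le_pow_mul {q : ℝ} {x : ℕ → ℝ} {ρ p a : ℕ} (h : DepthHead q x ρ p a) :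
    x (p + 1) ≤ q ^ a * x ρ := by
  cases a with
  | zero => simpa using h.2.1
  | succ d => exact h.2.1

theorem DepthHead.le_mul {q : ℝ} {x : ℕ → ℝ} {ρ p a : ℕ} (h : DepthHead q x ρ p a) :
    x (p + 1) ≤ q * x p := by
  cases a with
  | zero => exact h.2.2
  | succ d => exact h.2.2

theorem DepthHead.nonneg {q : ℝ} (hq : 0 ≤ q) {x : ℕ → ℝ} {ρ p a : ℕ} (h : DepthHead q x ρ p a)
    (hρ : 0 ≤ x ρ) : 0 ≤ x (p + 1) := by
  cases a with
  | zero => exact h.1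
  | succ d => exact (mul_nonneg (pow_nonneg hq _) hρ).trans h.1

theorem DepthHead.nonneg_nextRoot {q : ℝ} {x : ℕ → ℝ} {ρ p a : ℕ} (h : DepthHead q x ρ p a)
    (hρ : 0 ≤ x ρ) : 0 ≤ x (nextRoot ρ p a) := by
  cases a with
  | zero => exact h.1
  | succ d => exact hρ

/-- For depths `a < b` the regions meet where the lower bound of `b` is attained, for `a > b` where
the upper bound of `b` is attained; `f` is the slack. The last roots `ρ` and `σ` may differ as
indices, so only equality of their values is assumed, and it is passed on at the zeros of `f`. -/
theorem exists_depthHead_functional {q : ℝ} (hq : 1 ≤ q) (ρ σ p a b : ℕ) :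
    ∃ f : (ℕ → ℝ) →ₗ[ℝ] ℝ, ∀ x, DepthHead q x ρ p a → 0 ≤ x ρ → 0 ≤ f x ∧
      (x ρ = x σ → (f x = 0 ↔ DepthHead q x σ p b) ∧
        (f x = 0 → x (nextRoot ρ p a) = x (nextRoot σ p b))) := by
  have hq0 : 0 ≤ q := by linarith
  rcases lt_trichotomy a b with h | rfl | h
  · obtain ⟨e, rfl⟩ : ∃ e, b = e + 1 := ⟨b - 1, by omega⟩
    refine ⟨q ^ e • LinearMap.proj ρ - LinearMap.proj (p + 1), fun x hx hρ => ?_⟩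
    have h1 : q ^ a * x ρ ≤ q ^ e * x ρ :=
      mul_le_mul_of_nonneg_right (pow_le_pow_right₀ hq (by omega)) hρ
    have h2 := hx.le_pow_mul
    have h4 : q ^ e * x ρ ≤ q ^ (e + 1) * x ρ :=
      mul_le_mul_of_nonneg_right (pow_le_pow_right₀ hq (by omega)) hρ
    simp only [LinearMap.sub_apply, LinearMap.smul_apply, LinearMap.proj_apply, smul_eq_mul]
    refine ⟨by linarith, fun hr => ⟨?_, fun h3 => ?_⟩⟩
    · simp only [DepthHead, ← hr]
      exact ⟨fun h3 => ⟨by linarith, by linarith, hx.le_mul⟩, fun h3 => by linarith [h3.1]⟩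
    · cases a with
      | zero =>
        simp only [nextRoot, if_true, Nat.succ_ne_zero, if_false, ← hr]
        have : x ρ ≤ q ^ e * x ρ := by simpa using h1
        have h5 : x (p + 1) ≤ x ρ := by simpa using h2
        linarith
      | succ d => simpa [nextRoot] using hr
  · refine ⟨0, fun x hx hρ => ⟨le_rfl, fun hr => ⟨?_, fun _ => ?_⟩⟩⟩
    · simp only [LinearMap.zero_apply, true_iff]
      cases a <;> simpa [DepthHead, ← hr] using hx
    · simp only [nextRoot]
      split_ifs
      · rfl
      · exact hr
  · obtain ⟨d, rfl⟩ : ∃ d, a = d + 1 := ⟨a - 1, by omega⟩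
    refine ⟨LinearMap.proj (p + 1) - q ^ b • LinearMap.proj ρ, fun x hx hρ => ?_⟩
    have h1 : q ^ b * x ρ ≤ q ^ d * x ρ :=
      mul_le_mul_of_nonneg_right (pow_le_pow_right₀ hq (by omega)) hρ
    have h2 := hx.1
    have h0 := hx.nonneg hq0 hρ
    simp only [LinearMap.sub_apply, LinearMap.smul_apply, LinearMap.proj_apply, smul_eq_mul]
    refine ⟨by linarith, fun hr => ⟨⟨fun h3 => ?_, fun h3 => ?_⟩, fun h3 => ?_⟩⟩
    · cases b with
      | zero =>
        simp only [DepthHead, ← hr]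
        rw [pow_zero, one_mul] at h3
        exact ⟨h0, by linarith, hx.le_mul⟩
      | succ e =>
        simp only [DepthHead, ← hr]
        have h4 : q ^ e * x ρ ≤ q ^ (e + 1) * x ρ :=
          mul_le_mul_of_nonneg_right (pow_le_pow_right₀ hq (by omega)) hρ
        exact ⟨by linarith, by linarith, hx.le_mul⟩
    · have := h3.le_pow_mul
      rw [← hr] at this
      linarith
    · cases b with
      | zero =>
        simp only [nextRoot, if_true, Nat.succ_ne_zero, if_false]
        rw [pow_zero, one_mul] at h3
        linarith
      | succ d => simpa [nextRoot] using hr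

/-- A sum of nonnegative functionals vanishes iff every summand does, so the local functionals can
be added. -/
theorem exists_depthIneq_functional {q : ℝ} (hq : 1 ≤ q) (ρ σ p : ℕ) (u v : List ℕ)
    (huv : u.length = v.length) :
    ∃ f : (ℕ → ℝ) →ₗ[ℝ] ℝ, ∀ x, DepthIneq q x ρ p u → 0 ≤ x ρ → 0 ≤ f x ∧
      (x ρ = x σ → (f x = 0 ↔ DepthIneq q x σ p v)) := by
  induction u generalizing ρ σ p v with
  | nil =>
    obtain rfl := List.eq_nil_of_length_eq_zero huv.symm
    exact ⟨0, fun x _ _ => by simp [DepthIneq]⟩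
  | cons a u ih =>
    cases v with
    | nil => simp at huv
    | cons b v =>
      obtain ⟨f, hf⟩ := exists_depthHead_functional hq ρ σ p a b
      obtain ⟨g, hg⟩ := ih (nextRoot ρ p a) (nextRoot σ p b) (p + 1) v (by simpa using huv)
      refine ⟨f + g, fun x hx hρ => ?_⟩
      rw [depthIneq_cons] at hx
      obtain ⟨f1, f2⟩ := hf x hx.1 hρ
      obtain ⟨g1, g2⟩ := hg x hx.2 (hx.1.nonneg_nextRoot hρ)
      rw [LinearMap.add_apply, depthIneq_cons]
      refine ⟨add_nonneg f1 g1, fun hr => ?_⟩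
      obtain ⟨f3, f4⟩ := f2 hr
      rw [add_eq_zero_iff_of_nonneg f1 g1, ← f3]
      exact and_congr_right fun h0 => g2 (f4 h0)

/-- Up to the first difference the two sequences have the same last root. There the upper bound of
the smaller depth and the lower bound of the larger one pin the coordinate to a multiple of the
root's. -/
theorem exists_eq_mul_of_depthIneq {q : ℝ} (hq : 1 ≤ q) (ρ p : ℕ) (hρp : ρ ≤ p) (u v : List ℕ)
    (huv : u.length = v.length) (hne : u ≠ v) :
    ∃ i σ c, i < p + u.length ∧ σ ≤ i ∧ ∀ x, DepthIneq q x ρ p u → DepthIneq q x ρ p v → 0 ≤ x ρ →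
      x (i + 1) = c * x σ := by
  induction u generalizing ρ p v with
  | nil => exact absurd (List.eq_nil_of_length_eq_zero huv.symm).symm hne
  | cons a u ih =>
    cases v with
    | nil => simp at huv
    | cons b v =>
      simp only [depthIneq_cons, List.length_cons]
      have key : ∀ a b, a < b → ∀ x, DepthHead q x ρ p a → DepthHead q x ρ p b → 0 ≤ x ρ →
          x (p + 1) = q ^ a * x ρ := by
        intro a b hab x ha hb hρ
        obtain ⟨e, rfl⟩ : ∃ e, b = e + 1 := ⟨b - 1, by omega⟩
        refine le_antisymm ha.le_pow_mul (le_trans ?_ hb.1)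
        exact mul_le_mul_of_nonneg_right (pow_le_pow_right₀ hq (by omega)) hρ
      rcases lt_trichotomy a b with h | rfl | h
      · exact ⟨p, ρ, q ^ a, by omega, hρp, fun x h1 h2 => key a b h x h1.1 h2.1⟩
      · obtain ⟨i, σ, c, h1, h2, h3⟩ := ih (nextRoot ρ p a) (p + 1)
          (by unfold nextRoot; split_ifs <;> omega) v (by simpa using huv) (by simpa using hne)
        exact ⟨i, σ, c, by omega, h2, fun x h4 h5 h6 =>
          h3 x h4.2 h5.2 (h4.1.nonneg_nextRoot h6)⟩
      · exact ⟨p, ρ, q ^ b, by omega, hρp, fun x h1 h2 => key b a h x h2.1 h1.1⟩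

/-- The depth is the least `a` with `x (p + 1) ≤ q ^ a * x ρ`. Minimality gives the lower bound, and
`x (p + 1) ≤ q * x p` shows that the depth exceeds the previous one by at most one. -/
theorem exists_depthIneq {q : ℝ} {x : ℕ → ℝ} (N : ℕ) (ρ p d : ℕ) (hρ : 0 ≤ x ρ)
    (hd : x p ≤ q ^ d * x ρ) (hq : 0 ≤ q)
    (hx : ∀ i < N, 0 ≤ x (p + 1 + i) ∧ x (p + 1 + i) ≤ q * x (p + i)) :
    ∃ l, l.length = N ∧ IsDepthList d l ∧ DepthIneq q x ρ p l := by
  induction N generalizing ρ p d with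
  | zero => exact ⟨[], rfl, trivial, trivial⟩
  | succ N ih =>
    classical
    obtain ⟨h0, h1⟩ := hx 0 (Nat.succ_pos N)
    simp only [add_zero] at h0 h1
    have hx' : ∀ i < N, 0 ≤ x (p + 1 + 1 + i) ∧ x (p + 1 + 1 + i) ≤ q * x (p + 1 + i) := by
      intro i hi
      have := hx (i + 1) (by omega)
      rwa [show p + 1 + (i + 1) = p + 1 + 1 + i by ring,
        show p + (i + 1) = p + 1 + i by ring] at this
    have hd1 : x (p + 1) ≤ q ^ (d + 1) * x ρ := by
      rw [pow_succ', mul_assoc]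
      exact h1.trans (mul_le_mul_of_nonneg_left hd hq)
    have hex : ∃ a, x (p + 1) ≤ q ^ a * x ρ := ⟨d + 1, hd1⟩
    have ha := Nat.find_spec hex
    have had : Nat.find hex ≤ d + 1 := Nat.find_min' hex hd1
    rcases ha' : Nat.find hex with _ | e
    · rw [ha'] at ha
      obtain ⟨l, l1, l2, l3⟩ := ih (p + 1) (p + 1) 0 h0 (by simp) hx'
      exact ⟨0 :: l, by simp [l1], ⟨Nat.zero_le _, l2⟩, h0, by simpa using ha, h1, l3⟩
    · rw [ha'] at ha had
      have hmin := Nat.find_min hex (m := e) (by omega)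
      obtain ⟨l, l1, l2, l3⟩ := ih ρ (p + 1) (e + 1) hρ ha hx'
      exact ⟨(e + 1) :: l, by simp [l1], ⟨had, l2⟩, (not_le.1 hmin).le, ha, h1, l3⟩

theorem exists_functionals_depthIneq (q : ℝ) (ρ p : ℕ) (l : List ℕ) :
    ∃ Λ : List ((ℕ → ℝ) →ₗ[ℝ] ℝ), ∀ x, DepthIneq q x ρ p l ↔ ∀ f ∈ Λ, 0 ≤ f x := by
  obtain ⟨π, hπ⟩ : ∃ π : ℕ → (ℕ → ℝ) →ₗ[ℝ] ℝ, ∀ i x, π i x = x i :=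
    ⟨LinearMap.proj, fun _ _ => rfl⟩
  induction l generalizing ρ p with
  | nil => exact ⟨[], fun x => by simp [DepthIneq]⟩
  | cons a l ih =>
    obtain ⟨Λ, hΛ⟩ := ih (nextRoot ρ p a) (p + 1)
    cases a with
    | zero =>
      refine ⟨π (p + 1) :: (π ρ - π (p + 1)) ::
        (q • π p - π (p + 1)) :: Λ, fun x => ?_⟩
      rw [depthIneq_cons, hΛ]
      simp [DepthHead, and_assoc, hπ]
    | succ d =>
      refine ⟨(π (p + 1) - q ^ d • π ρ) ::
        (q ^ (d + 1) • π ρ - π (p + 1)) ::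
        (q • π p - π (p + 1)) :: Λ, fun x => ?_⟩
      rw [depthIneq_cons, hΛ]
      simp [DepthHead, and_assoc, hπ]

/-! ### The subdivision -/

/-- The linear part of the affine map `coords`. -/
def coordsLinear (n : ℕ) : (Fin n → ℝ) →ₗ[ℝ] ℕ → ℝ where
  toFun x
    | 0 => 0
    | i + 1 => entry x i
  map_add' x y := by
    ext i
    cases i with
    | zero => simp
    | succ i =>
      simp only [entry, Pi.add_apply]
      split_ifs <;> simp
  map_smul' c x := by
    ext i
    cases i with
    | zero => simp
    | succ i =>
      simp only [entry, Pi.smul_apply, RingHom.id_apply]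
      split_ifs <;> simp

theorem coords_eq {n : ℕ} (x : Fin n → ℝ) :
    coords x = coords (0 : Fin n → ℝ) + coordsLinear n x := by
  ext i
  cases i with
  | zero => simp [coords, coordsLinear]
  | succ i => simp [coords, coordsLinear, entry]

theorem mem_gayleyPolytope_iff {n : ℕ} {t : ℝ} {x : Fin n → ℝ} :
    x ∈ gayleyPolytope n t ↔
      ∀ i < n, 0 ≤ coords x (i + 1) ∧ coords x (i + 1) ≤ (1 + t) * coords x i := by
  have h : ∀ i : Fin n, (Fin.cons 1 x : Fin (n + 1) → ℝ) i.castSucc = coords x i := by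
    intro i
    obtain ⟨i, hi⟩ := i
    cases i with
    | zero => rfl
    | succ i =>
      have : (Fin.castSucc ⟨i + 1, hi⟩ : Fin (n + 1)) = Fin.succ ⟨i, by omega⟩ := rfl
      rw [this, Fin.cons_succ]
      exact (entry_val x ⟨i, by omega⟩).symm
  have h' : ∀ i : Fin n, coords x (i + 1) = x i := fun i => entry_val x i
  simp only [gayleyPolytope, Set.mem_ofPred_eq, h, Fin.forall_iff]
  exact forall₂_congr fun i hi => by rw [← h' ⟨i, hi⟩]

theorem isBounded_gayleyPolytope (n : ℕ) {t : ℝ} (ht : 0 ≤ t) :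
    Bornology.IsBounded (gayleyPolytope n t) := by
  refine (Metric.isBounded_Icc (0 : Fin n → ℝ) (fun _ => (1 + t) ^ n)).subset fun x hx => ?_
  rw [mem_gayleyPolytope_iff] at hx
  have hb : ∀ i ≤ n, coords x i ≤ (1 + t) ^ i := by
    intro i hi
    induction i with
    | zero => simp [coords]
    | succ i ih =>
      refine (hx i (by omega)).2.trans ?_
      rw [pow_succ']
      exact mul_le_mul_of_nonneg_left (ih (by omega)) (by linarith)
  have h' : ∀ i : Fin n, coords x (i + 1) = x i := fun i => entry_val x i
  refine ⟨fun i => ?_, fun i => ?_⟩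
  · rw [← h']; exact (hx i i.2).1
  · rw [← h']
    exact (hb _ i.2).trans (pow_le_pow_right₀ (by linarith) i.2)

theorem length_depths_tail {n : ℕ} (F : PlaneForestOn (n + 1)) : F.1.depths.tail.length = n := by
  rw [List.length_tail, length_depths, F.2]; rfl

theorem depths_eq_cons_tail {n : ℕ} (F : PlaneForestOn (n + 1)) :
    F.1.depths = 0 :: F.1.depths.tail := by
  obtain ⟨F, hF⟩ := F
  cases F with
  | nil => simp [numNodes] at hF
  | cons C R => rfl

theorem forestPolytope_subset {n : ℕ} {t : ℝ} (ht : 0 ≤ t) (F : PlaneForestOn (n + 1)) :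
    forestPolytope t F ⊆ gayleyPolytope n t := by
  intro x hx
  rw [mem_forestPolytope_iff ht] at hx
  rw [mem_gayleyPolytope_iff]
  intro i hi
  have h1 := depthIneq_nonneg (by linarith) hx zero_le_one i (by rwa [length_depths_tail])
  have h2 := depthIneq_le hx i (by rwa [length_depths_tail])
  rw [zero_add, add_comm] at h1
  rw [zero_add, zero_add, add_comm 1 i] at h2
  exact ⟨h1, h2⟩

theorem isBoundedPolytope_forestPolytope {n : ℕ} {t : ℝ} (ht : 0 ≤ t)
    (F : PlaneForestOn (n + 1)) : IsBoundedPolytope (forestPolytope t F) := by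
  refine ⟨?_, (isBounded_gayleyPolytope n ht).subset (forestPolytope_subset ht F)⟩
  obtain ⟨Λ, hΛ⟩ := exists_functionals_depthIneq (1 + t) 0 0 F.1.depths.tail
  let f : (Fin n → ℝ) →ₗ[ℝ] (Fin Λ.length → ℝ) :=
    LinearMap.pi fun i => -((Λ.get i).comp (coordsLinear n))
  refine ⟨Λ.length, LinearMap.toMatrix' f, fun i => Λ.get i (coords (0 : Fin n → ℝ)), ?_⟩
  ext x
  have hf : (LinearMap.toMatrix' f).mulVec x = f x := by
    rw [← Matrix.toLin'_apply, Matrix.toLin'_toMatrix']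
  rw [mem_forestPolytope_iff ht, hΛ, List.forall_mem_iff_get, Set.mem_ofPred_eq, hf]
  refine forall_congr' fun i => ?_
  rw [coords_eq, map_add]
  simp only [f, LinearMap.pi_apply, LinearMap.neg_apply, LinearMap.comp_apply]
  constructor <;> intro h <;> linarith

theorem isExposed_inter_forestPolytope {n : ℕ} {t : ℝ} (ht : 0 ≤ t) (F F' : PlaneForestOn (n + 1)) :
    IsExposed ℝ (forestPolytope t F) (forestPolytope t F ∩ forestPolytope t F') := by
  obtain ⟨f, hf⟩ := exists_depthIneq_functional (q := 1 + t) (by linarith) 0 0 0 F.1.depths.tail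
    F'.1.depths.tail (by rw [length_depths_tail, length_depths_tail])
  have hf' : ∀ x ∈ forestPolytope t F, 0 ≤ f (coords x) ∧
      (f (coords x) = 0 ↔ x ∈ forestPolytope t F') := by
    intro x hx
    rw [mem_forestPolytope_iff ht] at hx
    rw [mem_forestPolytope_iff ht]
    obtain ⟨h1, h2⟩ := hf _ hx zero_le_one
    exact ⟨h1, h2 rfl⟩
  -- Exposedness concerns nonempty intersections only. At the common point `y` the functional is
  -- `0`, its minimum, so the maximizers of its negative are its zeros.
  rintro ⟨y, hy, hy'⟩
  have hle : ∀ a b : Fin n → ℝ, -(f (coordsLinear n a)) ≤ -(f (coordsLinear n b)) ↔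
      f (coords b) ≤ f (coords a) := by
    intro a b
    rw [coords_eq a, coords_eq b, map_add, map_add]
    constructor <;> intro h <;> linarith
  refine ⟨LinearMap.toContinuousLinearMap (-(f.comp (coordsLinear n))), ?_⟩
  ext x
  simp only [Set.mem_inter_iff, Set.mem_ofPred_eq, LinearMap.coe_toContinuousLinearMap',
    LinearMap.neg_apply, LinearMap.comp_apply, hle]
  refine and_congr_right fun hx => ?_
  rw [← (hf' x hx).2]
  constructor
  · intro h z hz
    rw [h]; exact (hf' z hz).1
  · intro h
    exact le_antisymm ((h y hy).trans_eq ((hf' y hy).2.2 hy')) (hf' x hx).1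

theorem disjoint_interior_forestPolytope {n : ℕ} {t : ℝ} (ht : 0 ≤ t)
    {F F' : PlaneForestOn (n + 1)} (hne : F ≠ F') :
    Disjoint (interior (forestPolytope t F)) (interior (forestPolytope t F')) := by
  have hne' : F.1.depths.tail ≠ F'.1.depths.tail := by
    intro h
    apply hne
    apply Subtype.ext
    apply depths_injective
    rw [depths_eq_cons_tail F, depths_eq_cons_tail F', h]
  obtain ⟨i, σ, c, hi, hσ, h⟩ := exists_eq_mul_of_depthIneq (q := 1 + t) (by linarith) 0 0 le_rfl
    _ _ (by rw [length_depths_tail, length_depths_tail]) hne'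
  rw [length_depths_tail, zero_add] at hi
  have h' : ∀ x ∈ forestPolytope t F ∩ forestPolytope t F', coords x (i + 1) = c * coords x σ := by
    rintro x ⟨hx, hx'⟩
    rw [mem_forestPolytope_iff ht] at hx hx'
    exact h _ hx hx' zero_le_one
  rw [Set.disjoint_iff_inter_eq_empty, ← interior_inter, Set.eq_empty_iff_forall_notMem]
  intro x hx
  -- Moving coordinate `i` alone changes the left side of the equation `h'` but not the right side,
  -- as `σ ≤ i`; so no common point is interior.
  have hcont : Continuous fun s : ℝ => Function.update x ⟨i, hi⟩ s :=
    continuous_const.update _ continuous_id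
  have hopen := (isOpen_interior (s := forestPolytope t F ∩ forestPolytope t F')).preimage hcont
  have hmem : x ⟨i, hi⟩ ∈ (fun s : ℝ => Function.update x ⟨i, hi⟩ s) ⁻¹'
      interior (forestPolytope t F ∩ forestPolytope t F') := by
    simpa using hx
  obtain ⟨ε, hε, hball⟩ := Metric.isOpen_iff.1 hopen _ hmem
  have hs : x ⟨i, hi⟩ + ε / 2 ∈ Metric.ball (x ⟨i, hi⟩) ε := by
    rw [Metric.mem_ball, Real.dist_eq, add_sub_cancel_left, abs_of_pos (by positivity)]
    linarith
  have h1 := h' _ (interior_subset hx)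
  have h2 := h' _ (interior_subset (hball hs))
  have e1 : ∀ z : Fin n → ℝ, coords z (i + 1) = z ⟨i, hi⟩ := fun z => entry_val z ⟨i, hi⟩
  have e2 : coords (Function.update x ⟨i, hi⟩ (x ⟨i, hi⟩ + ε / 2)) σ = coords x σ := by
    cases σ with
    | zero => rfl
    | succ j =>
      have hj : j < n := by omega
      refine (entry_val _ ⟨j, hj⟩).trans (Eq.trans ?_ (entry_val x ⟨j, hj⟩).symm)
      refine Function.update_of_ne ?_ _ _
      simp only [ne_eq, Fin.mk.injEq]
      omega
  rw [e1] at h1 h2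
  rw [e2, ← h1] at h2
  simp only [Function.update_self] at h2
  linarith

theorem iUnion_forestPolytope (n : ℕ) {t : ℝ} (ht : 0 ≤ t) :
    ⋃ F : PlaneForestOn (n + 1), forestPolytope t F = gayleyPolytope n t := by
  refine Set.Subset.antisymm (Set.iUnion_subset fun F => forestPolytope_subset ht F) ?_
  intro x hx
  rw [mem_gayleyPolytope_iff] at hx
  obtain ⟨l, h1, h2, h3⟩ := exists_depthIneq (q := 1 + t) (x := coords x) n 0 0 0 zero_le_one
    (by simp) (by linarith) (fun i hi => by
      rw [zero_add, zero_add, add_comm 1 i]; exact hx i hi)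
  obtain ⟨F, hF⟩ := exists_depths_eq l h2
  have hn : F.numNodes = n + 1 := by rw [← length_depths, hF, List.length_cons, h1]
  refine Set.mem_iUnion.2 ⟨⟨F, hn⟩, ?_⟩
  rw [mem_forestPolytope_iff ht]
  simpa [hF] using h3

theorem isSubdivision_forestPolytope (n : ℕ) {t : ℝ} (ht : 0 ≤ t) :
    IsSubdivision (gayleyPolytope n t)
      (fun F : PlaneForestOn (n + 1) => forestPolytope t F) where
  finite := inferInstance
  polytope := isBoundedPolytope_forestPolytope ht
  cover := iUnion_forestPolytope n ht
  disjoint_interior _ _ hne := disjoint_interior_forestPolytope ht hne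
  inter_face F F' := ⟨isExposed_inter_forestPolytope ht F F', by
    rw [Set.inter_comm]; exact isExposed_inter_forestPolytope ht F' F⟩

/-! ### Null overlaps and the volume identities -/

theorem IsBoundedPolytope.convex {n : ℕ} {P : Set (Fin n → ℝ)} (hP : IsBoundedPolytope P) :
    Convex ℝ P := by
  obtain ⟨⟨k, A, b, rfl⟩, -⟩ := hP
  simp only [Set.ofPred_forall]
  refine convex_iInter fun i => ?_
  exact convex_halfSpace_le (f := fun x => (A.mulVec x) i)
    ⟨fun x y => by simp [Matrix.mulVec_add], fun c x => by simp [Matrix.mulVec_smul]⟩ _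

theorem IsBoundedPolytope.isClosed {n : ℕ} {P : Set (Fin n → ℝ)} (hP : IsBoundedPolytope P) :
    IsClosed P := by
  obtain ⟨⟨k, A, b, rfl⟩, -⟩ := hP
  simp only [Set.ofPred_forall]
  refine isClosed_iInter fun i => isClosed_le ?_ continuous_const
  exact (continuous_apply i).comp (Continuous.matrix_mulVec continuous_const continuous_id)

/-- A convex set without interior points lies in its frontier, which is a null set. -/
theorem interior_nonempty_of_volume_ne_zero {n : ℕ} {P : Set (Fin n → ℝ)} (hc : Convex ℝ P)
    (h : volume P ≠ 0) : (interior P).Nonempty := by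
  by_contra hP
  rw [Set.not_nonempty_iff_eq_empty] at hP
  apply h
  refine measure_mono_null ?_ (hc.addHaar_frontier volume)
  rw [frontier, hP, Set.sdiff_empty]
  exact subset_closure

theorem volume_real_forestPolytope {n : ℕ} {t : ℝ} (ht : 0 ≤ t) (F : PlaneForestOn (n + 1)) :
    (n ! : ℝ) * volume.real (forestPolytope t F) =
      edgeGenFun t (fun G : SimpleGraph (Fin (n + 1)) => graphPsi G = F.1) := by
  have h1 := F.1.degFact_pos
  have h2 := F.1.tailProd_pos
  rw [edgeGenFun_graphPsi t F.1 F.2, measureReal_def, volume_forestPolytope ht,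
    ENNReal.toReal_ofReal (by positivity)]
  field_simp

theorem volume_real_gayleyPolytope (n : ℕ) {t : ℝ} (ht : 0 ≤ t) :
    (n ! : ℝ) * volume.real (gayleyPolytope n t) =
      edgeGenFun t (fun _ : SimpleGraph (Fin (n + 1)) => True) := by
  classical
  have : Fintype (PlaneForestOn (n + 1)) := Fintype.ofFinite _
  have hpoly := isBoundedPolytope_forestPolytope (n := n) ht
  have hvol : volume.real (gayleyPolytope n t) =
      ∑ F : PlaneForestOn (n + 1), volume.real (forestPolytope t F) := by
    rw [measureReal_def, ← iUnion_forestPolytope n ht, measure_iUnion₀, tsum_fintype,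
      ENNReal.toReal_sum]
    · rfl
    · intro F _
      exact (hpoly F).2.measure_lt_top.ne
    · intro F F' hne
      -- An overlap of positive volume would be convex with nonempty interior, against the
      -- disjointness of the interiors.
      by_contra h
      have hI := interior_nonempty_of_volume_ne_zero
        ((hpoly F).convex.inter (hpoly F').convex) h
      rw [interior_inter, (disjoint_interior_forestPolytope ht hne).inter_eq] at hI
      exact Set.not_nonempty_empty hI
    · exact fun F => (hpoly F).isClosed.measurableSet.nullMeasurableSet
  rw [hvol, Finset.mul_sum, Finset.sum_congr rfl fun F _ => volume_real_forestPolytope ht F]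
  unfold edgeGenFun
  refine Eq.trans ?_ (Finset.sum_fiberwise _
    (fun G => (⟨graphPsi G, numNodes_graphPsi G⟩ : PlaneForestOn (n + 1))) _)
  refine Finset.sum_congr rfl fun F _ => Finset.sum_congr ?_ fun _ _ => rfl
  ext G
  simp [Subtype.ext_iff]

theorem edgeGenFun_graphPsi_eq_formula {n : ℕ} (t : ℝ) (F : PlaneForestOn (n + 1)) :
    edgeGenFun t (fun G : SimpleGraph (Fin (n + 1)) => graphPsi G = F.1) =
      ((n ! : ℝ) / ((F.1.redDegSeq.map Nat.factorial).prod : ℝ)) /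
          (∏ j ∈ Finset.Ico 1 F.1.numTrees, ((F.1.treeSizes.drop j).sum : ℝ)) *
        t ^ F.1.redDegSeq.sum *
        (1 + t) ^ (((n + 2 - F.1.numTrees).choose 2 : ℤ) -
          ∑ i : Fin F.1.redDegSeq.length, ((i : ℤ) + 1) * (F.1.redDegSeq.get i : ℤ)) := by
  have hnum := F.1.numNodes_eq
  rw [F.2] at hnum
  have hexp := F.1.forestExp_add_weightedSum
  rw [edgeGenFun_graphPsi t F.1 F.2, prod_redDegSeq, sum_redDegSeq, ← Nat.cast_prod,
    prod_Ico_treeSizes, sum_get_eq_weightedSum,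
    show n + 2 - F.1.numTrees = F.1.numNonroot + 1 by omega, ← hexp]
  -- The integer exponent is the natural number `forestExp`, so the power is an ordinary one.
  congr 1
  rw [Nat.cast_add, add_sub_cancel_right, zpow_natCast]

theorem theorem6p5 (n : ℕ) (t : ℝ) (ht : 0 ≤ t) :
    (∀ F : PlaneForestOn (n + 1),
      IsBoundedPolytope (forestPolytope t F) ∧
      (n ! : ℝ) * volume.real (forestPolytope t F) =
        edgeGenFun t (fun G : SimpleGraph (Fin (n + 1)) => graphPsi G = F.1) ∧
      edgeGenFun t (fun G : SimpleGraph (Fin (n + 1)) => graphPsi G = F.1) =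
        ((n ! : ℝ) / ((F.1.redDegSeq.map Nat.factorial).prod : ℝ)) /
            (∏ j ∈ Finset.Ico 1 F.1.numTrees, ((F.1.treeSizes.drop j).sum : ℝ)) *
          t ^ F.1.redDegSeq.sum *
          (1 + t) ^ (((n + 2 - F.1.numTrees).choose 2 : ℤ) -
            ∑ i : Fin F.1.redDegSeq.length, ((i : ℤ) + 1) * (F.1.redDegSeq.get i : ℤ))) ∧
    IsSubdivision (gayleyPolytope n t)
      (fun F : PlaneForestOn (n + 1) => forestPolytope t F) ∧
    (0 < t → ∀ F : PlaneForestOn (n + 1), (interior (forestPolytope t F)).Nonempty) ∧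
    (n ! : ℝ) * volume.real (gayleyPolytope n t) =
      edgeGenFun t (fun _ : SimpleGraph (Fin (n + 1)) => True) ∧
    edgeGenFun t (fun _ : SimpleGraph (Fin (n + 1)) => True) = (1 + t) ^ (n + 1).choose 2 := by
  refine ⟨fun F => ⟨isBoundedPolytope_forestPolytope ht F, volume_real_forestPolytope ht F,
    edgeGenFun_graphPsi_eq_formula t F⟩, isSubdivision_forestPolytope n ht, fun ht' F => ?_,
    volume_real_gayleyPolytope n ht, edgeGenFun_true (n + 1) t⟩
  refine interior_nonempty_of_volume_ne_zero (isBoundedPolytope_forestPolytope ht F).convex ?_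
  have h1 := F.1.degFact_pos
  have h2 := F.1.tailProd_pos
  rw [volume_forestPolytope ht]
  exact (ENNReal.ofReal_pos.2 (by positivity)).ne'
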